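/- Let $\mathcal S_4\subset\mathbb P^3_{\mathbb C}$ be the Schur quartic surface $x_0^4-x_0x_1^3-x_2^4+x_2x_3^3=0$. A line on $\mathcal S_4$ is said to be of the first kind if it meets both of the axes $\{x_2=x_3=0\}$ and $\{x_0=x_1=0\}$, and of the second kind otherwise. A transversal arrangement of lines on a smooth quartic surface is a finite set of lines on the surface such that any two of them are disjoint or meet transversally and such that the union of the lines is connected. For a transversal arrangement $\mathcal C$ of $n$ lines on a smooth quartic (hence K3) surface $X$ let $t_k$ be the number of points of $X$ that lie on exactly $k$ lines of $\mathcal C$, and put $f_0=\sum_{k\ge 2}t_k$, $f_1=\sum_{k\ge2}k\,t_k$. Let $Y\to X$ be the blow-up at the points that lie on at least three lines of $\mathcal C$, and let $\widetilde{\mathcal C}$ be the reduced total transform of $\mathcal C$. The log Chern slope of the log surface $(Y,\widetilde{\mathcal C})$ is defined as $$E(Y,\widetilde{\mathcal C})=\frac{\bar c_1^2}{\bar c_2}=\frac{-2n+3f_1-4f_0}{24-2n+f_1-f_0}.$$ **Proposition.** The surface $\mathcal S_4$ is smooth and contains exactly $64$ lines, $16$ of the first kind and $48$ of the second kind. The $48$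 lines of the second kind form a transversal arrangement with exactly $t_2=144$ double points and $t_3=64$ triple points, and with $t_k=0$ for all $k\ge4$. Hence the log Chern slope of the associated log surface is $$E(Y,\widetilde{\mathcal C})=\frac{64}{25}=2.56,\qquad \frac52<E(Y,\widetilde{\mathcal C})<\frac83 .$$ Moreover, there is exactly one transversal arrangement $\mathcal C$ of $48$ lines on $\mathcal S_4$ such that $E(Y,\widetilde{\mathcal C})=2.56$. -/

import Mathlib

open MvPolynomial

noncomputable section

namespace SchurQuarticLines

/-- The vector space `ℂ⁴` of homogeneous coordinates `(x₀, x₁, x₂, x₃)` on complex `ℙ³`. -/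
abbrev V : Type := Fin 4 → ℂ

/-- Complex projective three-space. -/
abbrev P3 : Type := Projectivization ℂ V

/-- The classical topology of `ℙ³`: the quotient topology from `ℂ⁴ ∖ {0}`. -/
instance : TopologicalSpace P3 :=
  TopologicalSpace.coinduced (Projectivization.mk' ℂ) inferInstance

/-- The surface `F = 0` in `ℙ³` is a smooth quartic: `F` is homogeneous of degree four and its
partial derivatives have no common zero on the surface. Such a surface is a projective K3
surface. -/
def IsSmoothQuartic (F : MvPolynomial (Fin 4) ℂ) : Prop :=
  F ≠ 0 ∧ F.IsHomogeneous 4 ∧ ∀ v : V, v ≠ 0 → eval v F = 0 → ∃ i, eval v (pderiv i F) ≠ 0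

/-- Lines of `ℙ³` are two-dimensional linear subspaces of `ℂ⁴`; this is the set of the lines that
are contained in the surface `F = 0`. -/
def linesOn (F : MvPolynomial (Fin 4) ℂ) : Set (Submodule ℂ V) :=
  {L | Module.finrank ℂ L = 2 ∧ ∀ v ∈ L, eval v F = 0}

/-- The linear subspace of `ℂ⁴` of which the projectivization is the embedded tangent space of the
surface `F = 0` at the point with homogeneous coordinates `v`. -/
def tangentSpace (F : MvPolynomial (Fin 4) ℂ) (v : V) : Submodule ℂ V :=
  LinearMap.ker (∑ i, eval v (pderiv i F) • (LinearMap.proj i : V →ₗ[ℂ] ℂ))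

/-- The set of points of `ℙ³` that lie on some line of `C`. -/
def unionOfLines (C : Set (Submodule ℂ V)) : Set P3 :=
  {p | ∃ L ∈ C, p.submodule ≤ L}

/-- A transversal arrangement of lines on the surface `F = 0`: a finite set of lines on the
surface (which are smooth irreducible rational curves) such that any two distinct lines meet
transversally wherever they meet (their tangent lines span the tangent plane of the surface), and
such that the union of the lines is connected. -/
structure IsTransversalArrangement (F : MvPolynomial (Fin 4) ℂ) (C : Set (Submodule ℂ V)) :
    Prop where
  finite : C.Finite
  subset : C ⊆ linesOn F
  transversal : ∀ L ∈ C, ∀ M ∈ C, L ≠ M → ∀ v ∈ L ⊓ M, v ≠ 0 → L ⊔ M = tangentSpace F v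
  connected : IsConnected (unionOfLines C)

/-- The number of lines of `C` through the point `p`. -/
def multiplicity (C : Set (Submodule ℂ V)) (p : P3) : ℕ :=
  {L ∈ C | p.submodule ≤ L}.ncard

/-- `t C k` is the number of `k`-fold points of `C` (used for `k ≥ 2`): the points through which
exactly `k` lines of `C` pass. -/
def t (C : Set (Submodule ℂ V)) (k : ℕ) : ℕ :=
  {p : P3 | multiplicity C p = k}.ncard

/-- `f₀ = ∑ t_k` over `k ≥ 2`; no point of a finite set `C` has a multiplicity above its
cardinality. -/
def f₀ (C : Set (Submodule ℂ V)) : ℕ := ∑ k ∈ Finset.Icc 2 C.ncard, t C k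

/-- `f₁ = ∑ k t_k` over `k ≥ 2`. -/
def f₁ (C : Set (Submodule ℂ V)) : ℕ := ∑ k ∈ Finset.Icc 2 C.ncard, k * t C k

/-- The first log Chern number `-2n + 3f₁ - 4f₀` of the log surface associated with a transversal
arrangement of `n` smooth rational curves on a K3 surface. -/
def logChernOneSq (C : Set (Submodule ℂ V)) : ℤ := -2 * C.ncard + 3 * f₁ C - 4 * f₀ C

/-- The second log Chern number `24 - 2n + f₁ - f₀` of the log surface associated with a
transversal arrangement of `n` smooth rational curves on a K3 surface. -/
def logChernTwo (C : Set (Submodule ℂ V)) : ℤ := 24 - 2 * C.ncard + f₁ C - f₀ C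

/-- The log Chern slope of the log surface associated with a transversal arrangement of smooth
rational curves on a K3 surface. -/
def logChernSlope (C : Set (Submodule ℂ V)) : ℚ := (logChernOneSq C : ℚ) / (logChernTwo C : ℚ)

/-- The form `x₀⁴ - x₀x₁³ - x₂⁴ + x₂x₃³` that defines the Schur quartic surface. -/
def schurQuartic : MvPolynomial (Fin 4) ℂ :=
  X 0 ^ 4 - X 0 * X 1 ^ 3 - X 2 ^ 4 + X 2 * X 3 ^ 3

/-- The axis `x₂ = x₃ = 0`. -/
def axisA : Submodule ℂ V :=
  LinearMap.ker (LinearMap.proj 2 : V →ₗ[ℂ] ℂ) ⊓ LinearMap.ker (LinearMap.proj 3 : V →ₗ[ℂ] ℂ)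

/-- The axis `x₀ = x₁ = 0`. -/
def axisB : Submodule ℂ V :=
  LinearMap.ker (LinearMap.proj 0 : V →ₗ[ℂ] ℂ) ⊓ LinearMap.ker (LinearMap.proj 1 : V →ₗ[ℂ] ℂ)

/-- The lines of the first kind on the Schur quartic: those that join a point of the surface on one
axis to a point of the surface on the other axis. -/
def firstKind : Set (Submodule ℂ V) :=
  {L ∈ linesOn schurQuartic | L ⊓ axisA ≠ ⊥ ∧ L ⊓ axisB ≠ ⊥}

/-- The lines of the second kind on the Schur quartic: all its other lines. -/
def secondKind : Set (Submodule ℂ V) := linesOn schurQuartic \ firstKind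

end SchurQuarticLines

end

noncomputable section

namespace SchurQuarticLines

open scoped Matrix

/-!
The equation of the Schur quartic reads `f(x₀, x₁) = f(x₂, x₃)` for the binary quartic
`f = x⁴ - xy³`. The lines that meet both axes join a root of `f` on one axis to a root of `f` on the
other; a line that misses an axis is the graph of a linear map `M` with `f ∘ M = f`, so that the
lines of the second kind correspond to the group of the `48` linear symmetries of `f`. The lines of
the second kind through the point `[v : Mv]` correspond to the symmetries that fix `v`: there are
three of them at the four roots of the Hessian of `f`, two at the six roots of the Jacobian of `f`
and its Hessian, and one elsewhere, which gives all the multiple points.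

For uniqueness, slope `64/25` with `48` lines says that `36 f₀ - 11 f₁` has the value it takes on
the lines of the second kind. Any other `48` lines arise from these by removing some and adding
equally many of the first kind. Twice the contribution of the multiple points drops by at most
`4 · 3 + 10 · 28 = 292` for each line removed, which has four triple points, six double points and
four points on lines of the first kind, and grows by at least `12 · 28 - 2 · 4 = 328` for each line
added, which meets the lines of the second kind in twelve points and has at most two further
multiple points. Hence the value changes unless nothing is exchanged.
-/

/-! ### Lines on a quartic surface -/

section TangentSpace

theorem eval_aeval_C_add_X_mul_C {σ R : Type*} [CommSemiring R] (F : MvPolynomial σ R)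
    (v u : σ → R) (c : R) :
    (aeval (fun i => Polynomial.C (v i) + Polynomial.X * Polynomial.C (u i)) F).eval c =
      eval (v + c • u) F := by
  rw [← Polynomial.coe_aeval_eq_eval, comp_aeval_apply, ← coe_aeval_eq_eval, RingHom.coe_coe]
  congr 2
  ext i
  simp [mul_comm c]

theorem eval_derivative_aeval_C_add_X_mul_C {σ R : Type*} [Fintype σ] [CommSemiring R]
    (F : MvPolynomial σ R) (v u : σ → R) :
    (Polynomial.derivative (aeval
      (fun i => Polynomial.C (v i) + Polynomial.X * Polynomial.C (u i)) F)).eval 0 =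
      ∑ i, eval v (pderiv i F) * u i := by
  classical
  induction F using MvPolynomial.induction_on with
  | C a => simp
  | add p q hp hq => simp only [map_add, Polynomial.eval_add, hp, hq, add_mul,
      Finset.sum_add_distrib]
  | mul_X p i hp =>
    rw [map_mul, aeval_X, Polynomial.derivative_mul, Polynomial.eval_add, Polynomial.eval_mul,
      Polynomial.eval_mul, hp, eval_aeval_C_add_X_mul_C]
    have hleibniz (j : σ) : eval v (pderiv j (p * X i)) * u j =
        eval v (pderiv j p) * u j * v i + eval v p * if j = i then u i else 0 := by
      obtain rfl | hij := eq_or_ne j i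
      · simp [mul_add, add_comm, mul_comm, mul_left_comm]
      · simp [hij.symm, hij, mul_comm, mul_left_comm]
    simp only [hleibniz, Finset.sum_add_distrib, Finset.sum_mul, ← Finset.mul_sum,
      Finset.sum_ite_eq', Finset.mem_univ, if_true]
    simp

theorem le_tangentSpace {F : MvPolynomial (Fin 4) ℂ} {L : Submodule ℂ V}
    (hL : ∀ v ∈ L, eval v F = 0) {v : V} (hv : v ∈ L) : L ≤ tangentSpace F v := by
  intro u hu
  have hvanish : aeval (fun i => Polynomial.C (v i) + Polynomial.X * Polynomial.C (u i)) F = 0 :=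
    Polynomial.funext fun c => by
      rw [eval_aeval_C_add_X_mul_C, hL _ (L.add_mem hv (L.smul_mem c hu)), Polynomial.eval_zero]
  have hderiv := eval_derivative_aeval_C_add_X_mul_C F v u
  rw [hvanish, Polynomial.derivative_zero, Polynomial.eval_zero] at hderiv
  simpa [tangentSpace] using hderiv.symm

theorem finrank_tangentSpace {F : MvPolynomial (Fin 4) ℂ} {v : V}
    (h : ∃ i, eval v (pderiv i F) ≠ 0) : Module.finrank ℂ (tangentSpace F v) = 3 := by
  obtain ⟨i, hi⟩ := h
  have hne : (∑ j, eval v (pderiv j F) • (LinearMap.proj j : V →ₗ[ℂ] ℂ)) ≠ 0 := fun h0 => hi <| by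
    simpa [Pi.single_apply] using LinearMap.congr_fun h0 (Pi.single i 1)
  have hker := Module.Dual.finrank_ker_add_one_of_ne_zero hne
  rw [Module.finrank_fin_fun] at hker
  exact Nat.succ_injective hker

theorem finrank_inf_le_one {K W : Type*} [Field K] [AddCommGroup W] [Module K W]
    {L M : Submodule K W} (hL : Module.finrank K L = 2) (hM : Module.finrank K M = 2)
    (hne : L ≠ M) : Module.finrank K ↥(L ⊓ M) ≤ 1 := by
  have := Module.finite_of_finrank_eq_succ hL
  have := Module.finite_of_finrank_eq_succ hM
  by_contra! h
  have hinfL : L ⊓ M = L := Submodule.eq_of_le_of_finrank_le inf_le_left (by omega)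
  have hinfM : L ⊓ M = M := Submodule.eq_of_le_of_finrank_le inf_le_right (by omega)
  exact hne (hinfL.symm.trans hinfM)

theorem sup_eq_tangentSpace {F : MvPolynomial (Fin 4) ℂ} (hF : IsSmoothQuartic F)
    {L M : Submodule ℂ V} (hL : L ∈ linesOn F) (hM : M ∈ linesOn F) (hne : L ≠ M) {v : V}
    (hv : v ∈ L ⊓ M) (hv0 : v ≠ 0) : L ⊔ M = tangentSpace F v := by
  refine Submodule.eq_of_le_of_finrank_le
    (sup_le (le_tangentSpace hL.2 hv.1) (le_tangentSpace hM.2 hv.2)) ?_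
  have hdim := Submodule.finrank_sup_add_finrank_inf_eq L M
  have hinf := finrank_inf_le_one hL.1 hM.1 hne
  have htangent := finrank_tangentSpace (hF.2.2 v hv0 (hL.2 v hv.1))
  rw [hL.1, hM.1] at hdim
  omega

end TangentSpace

/-! ### Multiplicities of points -/

section Multiplicity

variable {C D : Set (Submodule ℂ V)} {p : P3}

theorem submodule_mk_le {x : V} (hx : x ≠ 0) {L : Submodule ℂ V} :
    (Projectivization.mk ℂ x hx).submodule ≤ L ↔ x ∈ L := by
  rw [Projectivization.submodule_mk, Submodule.span_singleton_le_iff_mem]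

theorem multiplicity_mono (h : C ⊆ D) (hD : D.Finite) (p : P3) :
    multiplicity C p ≤ multiplicity D p :=
  Set.ncard_le_ncard (fun _ hL => ⟨h hL.1, hL.2⟩) (hD.subset fun _ hL => hL.1)

theorem multiplicity_le_ncard (hC : C.Finite) (p : P3) : multiplicity C p ≤ C.ncard :=
  Set.ncard_le_ncard (fun _ hL => hL.1) hC

theorem multiplicity_union (hC : C.Finite) (hD : D.Finite) (h : Disjoint C D) (p : P3) :
    multiplicity (C ∪ D) p = multiplicity C p + multiplicity D p := by
  rw [multiplicity, multiplicity, multiplicity, ← Set.ncard_union_eq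
    (h.mono (fun _ hL => hL.1) fun _ hL => hL.1) (hC.subset fun _ hL => hL.1)
    (hD.subset fun _ hL => hL.1)]
  congr 1
  ext L
  exact or_and_right

theorem one_le_multiplicity (hC : C.Finite) {L : Submodule ℂ V} (hL : L ∈ C)
    (hp : p.submodule ≤ L) : 1 ≤ multiplicity C p :=
  (Set.ncard_pos (hC.subset fun _ hM => hM.1)).2 ⟨L, hL, hp⟩

theorem exists_of_one_le_multiplicity (h : 1 ≤ multiplicity C p) : ∃ L ∈ C, p.submodule ≤ L :=
  Set.nonempty_of_ncard_ne_zero (Nat.one_le_iff_ne_zero.1 h)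

theorem finite_setOf_two_le_multiplicity (hC : C.Finite)
    (hdim : ∀ L ∈ C, Module.finrank ℂ L = 2) : {p | 2 ≤ multiplicity C p}.Finite := by
  have hmeet : ∀ L ∈ C, ∀ M ∈ C, {p : P3 | L ≠ M ∧ p.submodule ≤ L ⊓ M}.Finite := by
    refine fun L hL M hM => Set.Subsingleton.finite ?_
    rintro p ⟨hne, hp⟩ q ⟨-, hq⟩
    have hle := finrank_inf_le_one (hdim L hL) (hdim M hM) hne
    apply Projectivization.submodule_injective
    rw [Submodule.eq_of_le_of_finrank_le hp (by rwa [Projectivization.finrank_submodule]),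
      Submodule.eq_of_le_of_finrank_le hq (by rwa [Projectivization.finrank_submodule])]
  refine (hC.biUnion fun L hL => hC.biUnion fun M hM => hmeet L hL M hM).subset fun p hp => ?_
  obtain ⟨L, hL, M, hM, hne⟩ := (Set.one_lt_ncard (hC.subset fun _ h => h.1)).1 hp
  simp only [Set.mem_iUnion]
  exact ⟨L, hL.1, M, hM.1, hne, le_inf hL.2 hM.2⟩

open Classical in
theorem sum_mul_multiplicity {R : Type*} [CommSemiring R] (P : Finset P3) (hC : C.Finite)
    (g : P3 → R) :
    ∑ p ∈ P, g p * multiplicity C p = ∑ L ∈ hC.toFinset, ∑ p ∈ P with p.submodule ≤ L, g p := by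
  have hmult (p : P3) :
      (multiplicity C p : R) = ∑ L ∈ hC.toFinset, if p.submodule ≤ L then 1 else 0 := by
    rw [Finset.sum_boole, multiplicity, ← Set.ncard_coe_finset]
    congr 2
    ext L
    simp
  simp only [hmult, Finset.mul_sum, Finset.sum_filter]
  rw [Finset.sum_comm]
  simp only [mul_ite, mul_one, mul_zero]

open Classical in
theorem sum_mul_t_eq {R : Type*} [CommSemiring R] (hC : C.Finite) {P : Finset P3}
    (hP : ∀ p, 2 ≤ multiplicity C p → p ∈ P) (g : ℕ → R) :
    ∑ k ∈ Finset.Icc 2 C.ncard, g k * t C k =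
      ∑ p ∈ P, if 2 ≤ multiplicity C p then g (multiplicity C p) else 0 := by
  rw [← Finset.sum_filter, ← Finset.sum_fiberwise_of_maps_to (t := Finset.Icc 2 C.ncard)
    (g := multiplicity C) fun p hp =>
      Finset.mem_Icc.2 ⟨(Finset.mem_filter.1 hp).2, multiplicity_le_ncard hC p⟩]
  refine Finset.sum_congr rfl fun k hk => ?_
  have hfiber : t C k = {p ∈ {p ∈ P | 2 ≤ multiplicity C p} | multiplicity C p = k}.card := by
    rw [t, ← Set.ncard_coe_finset]
    congr 1
    ext p
    simp only [Set.mem_ofPred_eq, Finset.coe_filter, Finset.mem_filter]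
    refine ⟨?_, And.right⟩
    rintro rfl
    exact ⟨⟨hP p (Finset.mem_Icc.1 hk).1, (Finset.mem_Icc.1 hk).1⟩, rfl⟩
  rw [Finset.sum_congr rfl (g := fun _ => g k) fun p hp => by rw [(Finset.mem_filter.1 hp).2],
    Finset.sum_const, nsmul_eq_mul, mul_comm, hfiber]

theorem mul_t_eq (hC : C.Finite) (hdim : ∀ L ∈ C, Module.finrank ℂ L = 2) {k n : ℕ} (hk : 2 ≤ k)
    (h : ∀ L ∈ C, {p : P3 | p.submodule ≤ L ∧ multiplicity C p = k}.ncard = n) :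
    k * t C k = C.ncard * n := by
  classical
  have hfin : {p | multiplicity C p = k}.Finite :=
    (finite_setOf_two_le_multiplicity hC hdim).subset fun p hp => hk.trans (le_of_eq hp.symm)
  have hpoints : ∑ p ∈ hfin.toFinset, 1 * multiplicity C p = k * t C k := by
    rw [Finset.sum_congr rfl (g := fun _ => k) fun p hp => by
      rw [one_mul, (hfin.mem_toFinset.1 hp : multiplicity C p = k)], Finset.sum_const,
      ← Set.ncard_eq_toFinset_card _ hfin, smul_eq_mul, mul_comm, t]
  have hlines : ∀ L ∈ hC.toFinset, ∑ p ∈ hfin.toFinset with p.submodule ≤ L, 1 = n := by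
    intro L hL
    rw [← h L (hC.mem_toFinset.1 hL), Finset.sum_const, smul_eq_mul, mul_one,
      ← Set.ncard_coe_finset]
    congr 1
    ext p
    simp [and_comm]
  rw [← hpoints, Set.ncard_eq_toFinset_card C hC, ← smul_eq_mul,
    ← Finset.sum_eq_card_nsmul hlines]
  exact sum_mul_multiplicity hfin.toFinset hC fun _ => 1

end Multiplicity

/-! ### Powers in a field -/

theorem finite_setOf_pow_eq {R : Type*} [CommRing R] [IsDomain R] {n : ℕ} (hn : n ≠ 0) (c : R) :
    {x : R | x ^ n = c}.Finite := by
  classical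
  refine (Polynomial.nthRoots n c).toFinset.finite_toSet.subset fun x hx => ?_
  simpa [Polynomial.mem_nthRoots (Nat.pos_of_ne_zero hn)] using hx

theorem ncard_setOf_pow_eq {K : Type*} [Field K] [IsAlgClosed K] {n : ℕ} [NeZero (n : K)] {c : K}
    (hc : c ≠ 0) : {x : K | x ^ n = c}.ncard = n := by
  classical
  have hn : 0 < n := (NeZero.of_neZero_natCast K (n := n)).pos
  obtain ⟨ζ, hζ⟩ := HasEnoughRootsOfUnity.exists_primitiveRoot K n
  have hroots : {x : K | x ^ n = c} = (Polynomial.nthRoots n c).toFinset := by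
    ext x
    simp [Polynomial.mem_nthRoots hn]
  rw [hroots, Set.ncard_coe_finset, Multiset.toFinset_card_of_nodup (hζ.nthRoots_nodup hc),
    hζ.card_nthRoots, if_pos (IsAlgClosed.exists_pow_nat_eq c hn)]

/-! ### The symmetry group of the binary quartic -/

section Symmetries

variable {M : Matrix (Fin 2) (Fin 2) ℂ} {a b d κ : ℂ}

/-- The binary quartic form `x⁴ - xy³`, whose difference of two copies is the equation of the
Schur quartic. -/
def binaryQuartic (v : Fin 2 → ℂ) : ℂ := v 0 ^ 4 - v 0 * v 1 ^ 3

/-- The monoid of the matrices that preserve the binary quartic `x⁴ - xy³`. It is in fact a group;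
its elements parametrize the lines of the second kind. -/
def quarticSymmetries : Submonoid (Matrix (Fin 2) (Fin 2) ℂ) where
  carrier := {M | ∀ v, binaryQuartic (M *ᵥ v) = binaryQuartic v}
  one_mem' v := by rw [Matrix.one_mulVec]
  mul_mem' hM hN v := by rw [← Matrix.mulVec_mulVec, hM, hN]

/-- The pairs `(a, b)` with `a⁴ = ab³ = c`. For `c = 1` they parametrize the diagonal symmetries of
the binary quartic, for `c = 1/9` they give the first rows of its other symmetries. -/
def coefficientPairs (c : ℂ) : Set (ℂ × ℂ) := {p | p.1 ^ 4 = c ∧ p.1 * p.2 ^ 3 = c}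

/-- The diagonal matrix with entries `a` and `d`, a symmetry of the binary quartic if
`(a, d) ∈ coefficientPairs 1`. -/
def diagSymmetry (a d : ℂ) : Matrix (Fin 2) (Fin 2) ℂ := !![a, 0; 0, d]

/-- The general shape of a symmetry of the binary quartic that is not diagonal; `κ` is a cube root
of unity because the second column `(b, κb)` is a zero of the form. -/
def offDiagSymmetry (a b κ : ℂ) : Matrix (Fin 2) (Fin 2) ℂ := !![-a, b; 2 * κ * a, κ * b]

theorem diagSymmetry_mulVec (a d : ℂ) (v : Fin 2 → ℂ) :
    diagSymmetry a d *ᵥ v = ![a * v 0, d * v 1] := by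
  ext i
  fin_cases i <;> simp [diagSymmetry, Matrix.mulVec, dotProduct]

theorem offDiagSymmetry_mulVec (a b κ : ℂ) (v : Fin 2 → ℂ) :
    offDiagSymmetry a b κ *ᵥ v = ![b * v 1 - a * v 0, κ * (2 * a * v 0 + b * v 1)] := by
  ext i
  fin_cases i
  · change -a * v 0 + (b * v 1 + 0) = b * v 1 - a * v 0
    ring
  · change 2 * κ * a * v 0 + (κ * b * v 1 + 0) = κ * (2 * a * v 0 + b * v 1)
    ring

theorem diagSymmetry_one_one : diagSymmetry 1 1 = 1 := Matrix.one_fin_two.symm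

theorem ne_zero_of_mem_coefficientPairs {c : ℂ} (hc : c ≠ 0) (h : (a, b) ∈ coefficientPairs c) :
    a ≠ 0 ∧ b ≠ 0 := by
  constructor <;> rintro rfl <;> exact hc (by simpa using h.2.symm)

theorem ncard_coefficientPairs {c : ℂ} (hc : c ≠ 0) : (coefficientPairs c).ncard = 12 := by
  have himage : coefficientPairs c = (fun d => (c / d ^ 3, d)) '' {d | d ^ 12 = c ^ 3} := by
    ext ⟨a, d⟩
    constructor
    · intro h
      obtain ⟨-, hd⟩ := ne_zero_of_mem_coefficientPairs hc h
      have had : a = c / d ^ 3 := eq_div_of_mul_eq (pow_ne_zero 3 hd) h.2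
      refine ⟨d, mul_left_cancel₀ hc ?_, by rw [had]⟩
      calc c * d ^ 12 = (a * d ^ 3) ^ 4 := by rw [← h.1]; ring
        _ = c * c ^ 3 := by rw [h.2]; ring
    · rintro ⟨d, hd, h⟩
      obtain ⟨rfl, rfl⟩ := Prod.mk.inj h
      have hd0 : d ≠ 0 := by
        rintro rfl
        exact hc (by simpa using hd.symm)
      refine ⟨?_, div_mul_cancel₀ c (pow_ne_zero 3 hd0)⟩
      rw [div_pow, ← pow_mul, hd, div_eq_iff (pow_ne_zero 3 hc), pow_succ']
  rw [himage, Set.ncard_image_of_injective _ fun d e h => congrArg Prod.snd h,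
    ncard_setOf_pow_eq (pow_ne_zero 3 hc)]

theorem mem_quarticSymmetries_iff_coeff :
    M ∈ quarticSymmetries ↔
      M 0 0 ^ 4 - M 0 0 * M 1 0 ^ 3 = 1 ∧
      4 * M 0 0 ^ 3 * M 0 1 - M 0 1 * M 1 0 ^ 3 - 3 * M 0 0 * M 1 0 ^ 2 * M 1 1 = 0 ∧
      2 * M 0 0 ^ 2 * M 0 1 ^ 2 - M 0 1 * M 1 0 ^ 2 * M 1 1 - M 0 0 * M 1 0 * M 1 1 ^ 2 = 0 ∧
      4 * M 0 0 * M 0 1 ^ 3 - 3 * M 0 1 * M 1 0 * M 1 1 ^ 2 - M 0 0 * M 1 1 ^ 3 = -1 ∧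
      M 0 1 ^ 4 - M 0 1 * M 1 1 ^ 3 = 0 := by
  have hexpand (v : Fin 2 → ℂ) : binaryQuartic (M *ᵥ v) =
      (M 0 0 * v 0 + M 0 1 * v 1) ^ 4
        - (M 0 0 * v 0 + M 0 1 * v 1) * (M 1 0 * v 0 + M 1 1 * v 1) ^ 3 := by
    simp [binaryQuartic, Matrix.mulVec, dotProduct, Fin.sum_univ_two]
  constructor
  · intro h
    -- A binary quartic is determined by its values at five points of the projective line.
    have h0 := h ![1, 0]
    have h1 := h ![0, 1]
    have h2 := h ![1, 1]
    have h3 := h ![1, -1]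
    have h4 := h ![2, 1]
    rw [hexpand] at h0 h1 h2 h3 h4
    simp only [binaryQuartic, Matrix.cons_val_zero, Matrix.cons_val_one] at h0 h1 h2 h3 h4
    refine ⟨?_, ?_, ?_, ?_, ?_⟩
    · linear_combination h0
    · linear_combination (-2) * h0 + (1 / 2) * h1 - (1 / 2) * h2 - (1 / 6) * h3 + (1 / 6) * h4
    · linear_combination (-1 / 3) * h0 - (1 / 3) * h1 + (1 / 6) * h2 + (1 / 6) * h3
    · linear_combination 2 * h0 - (1 / 2) * h1 + h2 - (1 / 3) * h3 - (1 / 6) * h4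
    · linear_combination h1
  · rintro ⟨h0, h1, h2, h3, h4⟩ v
    rw [hexpand, binaryQuartic]
    linear_combination v 0 ^ 4 * h0 + v 0 ^ 3 * v 1 * h1 + 3 * v 0 ^ 2 * v 1 ^ 2 * h2
      + v 0 * v 1 ^ 3 * h3 + v 1 ^ 4 * h4

theorem diagSymmetry_mem (h : (a, d) ∈ coefficientPairs 1) :
    diagSymmetry a d ∈ quarticSymmetries := by
  intro v
  rw [diagSymmetry_mulVec]
  simp only [binaryQuartic, Matrix.cons_val_zero, Matrix.cons_val_one]
  linear_combination v 0 ^ 4 * h.1 - v 0 * v 1 ^ 3 * h.2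

theorem offDiagSymmetry_mem (h : (a, b) ∈ coefficientPairs 9⁻¹) (hκ : κ ^ 3 = 1) :
    offDiagSymmetry a b κ ∈ quarticSymmetries := by
  intro v
  rw [offDiagSymmetry_mulVec]
  simp only [binaryQuartic, Matrix.cons_val_zero, Matrix.cons_val_one]
  linear_combination 9 * v 0 ^ 4 * h.1 - 9 * v 0 * v 1 ^ 3 * h.2
    - (b * v 1 - a * v 0) * (2 * a * v 0 + b * v 1) ^ 3 * hκ

theorem exists_eq_diagSymmetry (hM : M ∈ quarticSymmetries) (hb : M 0 1 = 0) :
    ∃ a d, (a, d) ∈ coefficientPairs 1 ∧ M = diagSymmetry a d := by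
  obtain ⟨h0, h1, -, h3, -⟩ := mem_quarticSymmetries_iff_coeff.1 hM
  rw [hb] at h1 h3
  have ha : M 0 0 ≠ 0 := by
    intro h
    norm_num [h] at h0
  have had : M 0 0 * M 1 1 ^ 3 = 1 := by linear_combination -h3
  have hd : M 1 1 ≠ 0 := by
    intro h
    norm_num [h] at had
  have hc : M 1 0 = 0 := by
    have : (3 * M 0 0 * M 1 1) * M 1 0 ^ 2 = 0 := by linear_combination -h1
    simpa [ha, hd] using this
  refine ⟨M 0 0, M 1 1, ⟨?_, had⟩, ?_⟩
  · rw [hc] at h0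
    linear_combination h0
  · rw [diagSymmetry, Matrix.eta_fin_two M, hb, hc]
    simp

theorem exists_eq_offDiagSymmetry (hM : M ∈ quarticSymmetries) (hb : M 0 1 ≠ 0) :
    ∃ a b κ, (a, b) ∈ coefficientPairs 9⁻¹ ∧ κ ^ 3 = 1 ∧ M = offDiagSymmetry a b κ := by
  obtain ⟨h0, -, h2, h3, h4⟩ := mem_quarticSymmetries_iff_coeff.1 hM
  obtain ⟨κ, hκ⟩ : ∃ κ, M 1 1 = κ * M 0 1 := ⟨M 1 1 / M 0 1, (div_mul_cancel₀ _ hb).symm⟩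
  rw [hκ] at h2 h3 h4
  have hκ3 : κ ^ 3 = 1 := by
    apply mul_right_cancel₀ (pow_ne_zero 4 hb)
    linear_combination -h4
  have hκ0 : κ ≠ 0 := by
    rintro rfl
    norm_num at hκ3
  have hfactor : (2 * M 0 0 * κ + M 1 0) * (M 0 0 * κ - M 1 0) = 0 := by
    apply mul_left_cancel₀ (mul_ne_zero (pow_ne_zero 2 hb) hκ0)
    linear_combination h2 + 2 * M 0 0 ^ 2 * M 0 1 ^ 2 * hκ3
  have hc : M 1 0 = -2 * κ * M 0 0 := by
    rcases mul_eq_zero.1 hfactor with h | h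
    · linear_combination h
    · have hdegenerate : M 1 0 = M 0 0 * κ := by linear_combination -h
      rw [hdegenerate] at h0
      exact absurd (by linear_combination h0 + M 0 0 ^ 4 * hκ3) (zero_ne_one (α := ℂ))
  rw [hc] at h0 h3
  refine ⟨-M 0 0, M 0 1, κ, ⟨?_, ?_⟩, hκ3, ?_⟩
  · linear_combination (1 / 9) * h0 - (8 / 9) * M 0 0 ^ 4 * hκ3
  · linear_combination (-1 / 9) * h3 + (5 / 9) * M 0 0 * M 0 1 ^ 3 * hκ3
  · rw [offDiagSymmetry, Matrix.eta_fin_two M, hκ, hc]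
    simp

theorem mem_quarticSymmetries_iff :
    M ∈ quarticSymmetries ↔ (∃ a d, (a, d) ∈ coefficientPairs 1 ∧ M = diagSymmetry a d) ∨
      ∃ a b κ, (a, b) ∈ coefficientPairs 9⁻¹ ∧ κ ^ 3 = 1 ∧ M = offDiagSymmetry a b κ := by
  constructor
  · intro hM
    by_cases hb : M 0 1 = 0
    · exact Or.inl (exists_eq_diagSymmetry hM hb)
    · exact Or.inr (exists_eq_offDiagSymmetry hM hb)
  · rintro (⟨a, d, h, rfl⟩ | ⟨a, b, κ, h, hκ, rfl⟩)
    · exact diagSymmetry_mem h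
    · exact offDiagSymmetry_mem h hκ

theorem ncard_quarticSymmetries :
    (quarticSymmetries : Set (Matrix (Fin 2) (Fin 2) ℂ)).ncard = 48 := by
  have hne : (9⁻¹ : ℂ) ≠ 0 := by norm_num
  have hdiag : ((fun p : ℂ × ℂ => diagSymmetry p.1 p.2) '' coefficientPairs 1).ncard = 12 := by
    rw [Set.ncard_image_of_injective, ncard_coefficientPairs one_ne_zero]
    rintro ⟨a, d⟩ ⟨a', d'⟩ h
    simpa [diagSymmetry] using h
  have hoff : ((fun q : (ℂ × ℂ) × ℂ => offDiagSymmetry q.1.1 q.1.2 q.2) ''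
      (coefficientPairs 9⁻¹ ×ˢ {κ | κ ^ 3 = 1})).ncard = 36 := by
    rw [Set.InjOn.ncard_image, Set.ncard_prod, ncard_coefficientPairs hne,
      ncard_setOf_pow_eq one_ne_zero]
    rintro ⟨⟨a, b⟩, κ⟩ ⟨hab, -⟩ ⟨⟨a', b'⟩, κ'⟩ - h
    obtain ⟨-, hb⟩ := ne_zero_of_mem_coefficientPairs hne hab
    obtain ⟨⟨rfl, rfl⟩, -, hκ⟩ := by simpa [offDiagSymmetry] using h
    rw [mul_right_cancel₀ hb hκ]
  have hunion : (quarticSymmetries : Set (Matrix (Fin 2) (Fin 2) ℂ)) =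
      (fun p : ℂ × ℂ => diagSymmetry p.1 p.2) '' coefficientPairs 1 ∪
      (fun q : (ℂ × ℂ) × ℂ => offDiagSymmetry q.1.1 q.1.2 q.2) ''
        (coefficientPairs 9⁻¹ ×ˢ {κ | κ ^ 3 = 1}) := by
    ext M
    simp only [SetLike.mem_coe, mem_quarticSymmetries_iff, Set.mem_union, Set.mem_image,
      Set.mem_prod, Prod.exists, Set.mem_ofPred_eq, and_assoc, eq_comm]
  rw [hunion, Set.ncard_union_eq _ (Set.finite_of_ncard_ne_zero (by rw [hdiag]; norm_num))
    (Set.finite_of_ncard_ne_zero (by rw [hoff]; norm_num)), hdiag, hoff]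
  rw [Set.disjoint_left]
  rintro _ ⟨p, -, rfl⟩ ⟨⟨⟨a, b⟩, κ⟩, ⟨hab, -⟩, h⟩
  exact (ne_zero_of_mem_coefficientPairs hne hab).2 (congrFun₂ h 0 1)

theorem isUnit_det_of_mem_quarticSymmetries (hM : M ∈ quarticSymmetries) : IsUnit M.det := by
  rw [isUnit_iff_ne_zero]
  rcases mem_quarticSymmetries_iff.1 hM with ⟨a, d, h, rfl⟩ | ⟨a, b, κ, h, hκ, rfl⟩
  · obtain ⟨ha, hd⟩ := ne_zero_of_mem_coefficientPairs one_ne_zero h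
    simp [diagSymmetry, ha, hd]
  · obtain ⟨ha, hb⟩ := ne_zero_of_mem_coefficientPairs (by norm_num) h
    have hκ0 : κ ≠ 0 := by
      rintro rfl
      norm_num at hκ
    have hdet : (offDiagSymmetry a b κ).det = -3 * a * b * κ := by
      rw [offDiagSymmetry, Matrix.det_fin_two_of]
      ring
    simp [hdet, ha, hb, hκ0]

theorem inv_mem_quarticSymmetries (hM : M ∈ quarticSymmetries) : M⁻¹ ∈ quarticSymmetries := by
  intro v
  rw [← hM, Matrix.mulVec_mulVec,
    Matrix.mul_nonsing_inv _ (isUnit_det_of_mem_quarticSymmetries hM), Matrix.one_mulVec]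

end Symmetries

/-! ### Stabilizers of vectors -/

section Fixer

variable {M : Matrix (Fin 2) (Fin 2) ℂ} {v : Fin 2 → ℂ} {y z : ℂ}

/-- The stabilizer of the vector `v` in the group of symmetries of the binary quartic. -/
def fixer (v : Fin 2 → ℂ) : Set (Matrix (Fin 2) (Fin 2) ℂ) := {M ∈ quarticSymmetries | M *ᵥ v = v}

/-- The Hessian determinant of the binary quartic `x⁴ - xy³`, divided by `-9`. -/
def hessian (v : Fin 2 → ℂ) : ℂ := v 1 * (v 1 ^ 3 + 8 * v 0 ^ 3)

/-- The Jacobian determinant of the binary quartic `x⁴ - xy³` and `hessian`, divided by `-4`. -/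
def sexticCovariant (v : Fin 2 → ℂ) : ℂ := v 1 ^ 6 - 20 * v 0 ^ 3 * v 1 ^ 3 - 8 * v 0 ^ 6

theorem one_mem_fixer (v : Fin 2 → ℂ) : 1 ∈ fixer v := ⟨one_mem _, Matrix.one_mulVec v⟩

theorem fixer_smul {s : ℂ} (hs : s ≠ 0) (v : Fin 2 → ℂ) : fixer (s • v) = fixer v := by
  ext M
  simp only [fixer, Set.mem_ofPred_eq, Matrix.mulVec_smul, (smul_right_injective _ hs).eq_iff]

theorem ncard_setOf_mulVec_eq (hM : M ∈ quarticSymmetries) (v : Fin 2 → ℂ) :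
    {N ∈ quarticSymmetries | N *ᵥ v = M *ᵥ v}.ncard = (fixer v).ncard := by
  have hu := isUnit_det_of_mem_quarticSymmetries hM
  have hcoset : {N ∈ quarticSymmetries | N *ᵥ v = M *ᵥ v} = (M * ·) '' fixer v := by
    ext N
    constructor
    · rintro ⟨hN, h⟩
      refine ⟨M⁻¹ * N, ⟨mul_mem (inv_mem_quarticSymmetries hM) hN, ?_⟩,
        Matrix.mul_nonsing_inv_cancel_left _ _ hu⟩
      rw [← Matrix.mulVec_mulVec, h, Matrix.mulVec_mulVec, Matrix.nonsing_inv_mul _ hu,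
        Matrix.one_mulVec]
    · rintro ⟨N, ⟨hN, h⟩, rfl⟩
      exact ⟨mul_mem hM hN, by rw [← Matrix.mulVec_mulVec, h]⟩
  rw [hcoset, Set.ncard_image_of_injective _
    ((Matrix.isUnit_iff_isUnit_det M).2 hu).mul_right_injective]

theorem ncard_fixer_zero_one : (fixer ![0, 1]).ncard = 1 := by
  suffices fixer ![0, 1] = {1} by rw [this, Set.ncard_singleton]
  refine Set.eq_singleton_iff_unique_mem.2 ⟨one_mem_fixer _, fun M ⟨hM, hv⟩ => ?_⟩
  rcases mem_quarticSymmetries_iff.1 hM with ⟨a, d, h, rfl⟩ | ⟨a, b, κ, h, -, rfl⟩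
  · obtain rfl : d = 1 := by simpa [diagSymmetry] using congrFun hv 1
    obtain rfl : a = 1 := by simpa using h.2
    exact diagSymmetry_one_one
  · exact absurd (by simpa [offDiagSymmetry] using congrFun hv 0)
      (ne_zero_of_mem_coefficientPairs (by norm_num) h).2

theorem ncard_fixer_one_zero : (fixer ![1, 0]).ncard = 3 := by
  have hfixer : fixer ![1, 0] = diagSymmetry 1 '' {d | d ^ 3 = 1} := by
    ext M
    constructor
    · rintro ⟨hM, hv⟩
      rcases mem_quarticSymmetries_iff.1 hM with ⟨a, d, h, rfl⟩ | ⟨a, b, κ, h, hκ, rfl⟩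
      · obtain rfl : a = 1 := by simpa [diagSymmetry] using congrFun hv 0
        exact ⟨d, by simpa using h.2, rfl⟩
      · obtain ⟨ha, -⟩ := ne_zero_of_mem_coefficientPairs (by norm_num) h
        obtain rfl : κ = 0 := by simpa [offDiagSymmetry, ha] using congrFun hv 1
        norm_num at hκ
    · rintro ⟨d, hd, rfl⟩
      refine ⟨diagSymmetry_mem ⟨one_pow 4, (one_mul _).trans hd⟩, ?_⟩
      rw [diagSymmetry_mulVec]
      simp
  have hinj : Function.Injective (diagSymmetry 1) := fun d d' h => by
    simpa [diagSymmetry] using h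
  rw [hfixer, Set.ncard_image_of_injective _ hinj, ncard_setOf_pow_eq one_ne_zero]

theorem fixer_one_eq (hy : y ≠ 0) :
    fixer ![1, y] = insert 1 ((fun a => offDiagSymmetry a ((1 + a) / y) (y / (1 + 3 * a))) ''
      {a | a ^ 4 = 9⁻¹ ∧ (1 + 3 * a) ^ 3 = y ^ 3}) := by
  ext M
  constructor
  · rintro ⟨hM, hv⟩
    rcases mem_quarticSymmetries_iff.1 hM with ⟨a, d, h, rfl⟩ | ⟨a, b, κ, h, hκ, rfl⟩
    · rw [diagSymmetry_mulVec] at hv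
      obtain ⟨rfl, rfl⟩ : a = 1 ∧ d = 1 := by simpa [hy] using hv
      exact Or.inl diagSymmetry_one_one
    · rw [offDiagSymmetry_mulVec] at hv
      obtain ⟨hv0, hv1⟩ : b * y - a = 1 ∧ κ * (2 * a + b * y) = y := by simpa using hv
      have hκy : κ * (1 + 3 * a) = y := by linear_combination hv1 - κ * hv0
      have ha : 1 + 3 * a ≠ 0 := right_ne_zero_of_mul (hκy.trans_ne hy)
      refine Or.inr ⟨a, ⟨h.1, ?_⟩, ?_⟩
      · rw [← hκy, mul_pow, hκ, one_mul]
      · have hby : b * y = 1 + a := by linear_combination hv0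
        rw [eq_div_of_mul_eq ha hκy, eq_div_of_mul_eq hy hby]
  · rintro (rfl | ⟨a, ⟨ha, hay⟩, rfl⟩)
    · exact one_mem_fixer _
    · have ha0 : 1 + 3 * a ≠ 0 := fun h => hy (by simpa [h] using hay.symm)
      refine ⟨offDiagSymmetry_mem ⟨ha, ?_⟩ ?_, ?_⟩
      · rw [div_pow, mul_div_assoc', div_eq_iff (pow_ne_zero 3 hy)]
        linear_combination (1 / 9) * hay + ha
      · rw [div_pow, hay, div_self (pow_ne_zero 3 hy)]
      · rw [offDiagSymmetry_mulVec]
        simp only [Matrix.cons_val_zero, Matrix.cons_val_one]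
        congr! 2 <;> field_simp <;> ring

theorem ncard_fixer_one_eq (hy : y ≠ 0) :
    (fixer ![1, y]).ncard = {a : ℂ | a ^ 4 = 9⁻¹ ∧ (1 + 3 * a) ^ 3 = y ^ 3}.ncard + 1 := by
  have hfin : {a : ℂ | a ^ 4 = 9⁻¹ ∧ (1 + 3 * a) ^ 3 = y ^ 3}.Finite :=
    (finite_setOf_pow_eq four_ne_zero _).subset fun _ h => h.1
  have hinj : Function.Injective
      fun a => offDiagSymmetry a ((1 + a) / y) (y / (1 + 3 * a)) := fun a a' h => by
    simpa [offDiagSymmetry] using congrFun₂ h 0 0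
  rw [fixer_one_eq hy, Set.ncard_insert_of_notMem _ (hfin.image _),
    Set.ncard_image_of_injective _ hinj]
  rintro ⟨a, ⟨ha, -⟩, h⟩
  obtain rfl : a = -1 := by simpa [offDiagSymmetry, neg_eq_iff_eq_neg] using congrFun₂ h 0 0
  norm_num at ha

theorem pow_four_eq_and_cube_eq_iff {a : ℂ} :
    a ^ 4 = 9⁻¹ ∧ (1 + 3 * a) ^ 3 = z ↔
      a ^ 2 = -3⁻¹ ∧ z = -8 ∨ a ^ 2 = 3⁻¹ ∧ z = 10 + 18 * a := by
  constructor
  -- On the factors `3a² = ∓1` of `9a⁴ = 1` the cube of `1 + 3a` is constant, respectively linear.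
  · rintro ⟨ha, haz⟩
    have hfactor : (a ^ 2 + 3⁻¹) * (a ^ 2 - 3⁻¹) = 0 := by linear_combination ha
    rcases mul_eq_zero.1 hfactor with h | h
    · exact Or.inl ⟨by linear_combination h, by linear_combination -haz + 27 * (1 + a) * h⟩
    · exact Or.inr ⟨by linear_combination h, by linear_combination -haz + 27 * (1 + a) * h⟩
  · rintro (⟨ha, rfl⟩ | ⟨ha, rfl⟩)
    · exact ⟨by linear_combination (a ^ 2 - 3⁻¹) * ha, by linear_combination 27 * (1 + a) * ha⟩
    · exact ⟨by linear_combination (a ^ 2 + 3⁻¹) * ha, by linear_combination 27 * (1 + a) * ha⟩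

theorem ncard_setOf_pow_four_eq_and_cube_eq (z : ℂ) :
    {a : ℂ | a ^ 4 = 9⁻¹ ∧ (1 + 3 * a) ^ 3 = z}.ncard =
      if z = -8 then 2 else if (z - 10) ^ 2 = 108 then 1 else 0 := by
  simp only [pow_four_eq_and_cube_eq_iff]
  split_ifs with h8 h108
  · subst h8
    have hset : {a : ℂ | a ^ 2 = -3⁻¹ ∧ (-8 : ℂ) = -8 ∨ a ^ 2 = 3⁻¹ ∧ -8 = 10 + 18 * a} =
        {a | a ^ 2 = -3⁻¹} := by
      ext a
      refine ⟨?_, fun ha => Or.inl ⟨ha, rfl⟩⟩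
      rintro (⟨ha, -⟩ | ⟨ha, hz⟩)
      · exact ha
      · obtain rfl : a = -1 := by linear_combination (-1 / 18) * hz
        norm_num at ha
    rw [hset, ncard_setOf_pow_eq (by norm_num)]
  · refine Set.ncard_eq_one.2 ⟨(z - 10) / 18, Set.eq_singleton_iff_unique_mem.2 ⟨?_, ?_⟩⟩
    · exact Or.inr ⟨by linear_combination (1 / 324) * h108, by ring⟩
    · rintro a (⟨-, hz⟩ | ⟨-, hz⟩)
      · exact absurd hz h8
      · linear_combination (-1 / 18) * hz
  · suffices h : {a | a ^ 2 = -3⁻¹ ∧ z = -8 ∨ a ^ 2 = 3⁻¹ ∧ z = 10 + 18 * a} = ∅ by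
      rw [h, Set.ncard_empty]
    rw [Set.eq_empty_iff_forall_notMem]
    rintro a (⟨-, hz⟩ | ⟨ha, hz⟩)
    · exact h8 hz
    · exact h108 (by rw [hz]; linear_combination 324 * ha)

theorem exists_eq_smul_or_eq_smul {K : Type*} [Field K] {v : Fin 2 → K} (hv : v ≠ 0) :
    ∃ s : K, s ≠ 0 ∧ (v = s • ![0, 1] ∨ ∃ y, v = s • ![1, y]) := by
  by_cases h0 : v 0 = 0
  · refine ⟨v 1, fun h1 => hv ?_, Or.inl ?_⟩ <;> ext i <;> fin_cases i <;> simp [*]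
  · refine ⟨v 0, h0, Or.inr ⟨v 1 / v 0, ?_⟩⟩
    ext i
    fin_cases i <;> simp [mul_div_cancel₀, h0]

theorem ncard_fixer (hv : v ≠ 0) :
    (fixer v).ncard = if hessian v = 0 then 3 else if sexticCovariant v = 0 then 2 else 1 := by
  obtain ⟨s, hs, rfl | ⟨y, rfl⟩⟩ := exists_eq_smul_or_eq_smul hv
  · rw [fixer_smul hs, ncard_fixer_zero_one]
    simp [hessian, sexticCovariant, hs]
  have hhessian : hessian (s • ![1, y]) = 0 ↔ y = 0 ∨ y ^ 3 = -8 := by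
    have : hessian (s • ![1, y]) = s ^ 4 * (y * (y ^ 3 + 8)) := by
      simp only [hessian, Pi.smul_apply, smul_eq_mul, Matrix.cons_val_zero, Matrix.cons_val_one]
      ring
    rw [this, mul_eq_zero_iff_left (pow_ne_zero 4 hs), mul_eq_zero, add_eq_zero_iff_eq_neg]
  have hsextic : sexticCovariant (s • ![1, y]) = 0 ↔ (y ^ 3 - 10) ^ 2 = 108 := by
    have : sexticCovariant (s • ![1, y]) = s ^ 6 * ((y ^ 3 - 10) ^ 2 - 108) := by
      simp only [sexticCovariant, Pi.smul_apply, smul_eq_mul, Matrix.cons_val_zero,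
        Matrix.cons_val_one]
      ring
    rw [this, mul_eq_zero_iff_left (pow_ne_zero 6 hs), sub_eq_zero]
  simp only [fixer_smul hs, hhessian, hsextic]
  obtain rfl | hy := eq_or_ne y 0
  · simp [ncard_fixer_one_zero]
  · rw [ncard_fixer_one_eq hy, ncard_setOf_pow_four_eq_and_cube_eq]
    simp only [hy, false_or]
    split_ifs <;> rfl

theorem ncard_fixer_le (hv : v ≠ 0) : (fixer v).ncard ≤ 3 := by
  rw [ncard_fixer hv]
  split_ifs <;> norm_num

theorem ncard_fixer_eq_three_iff (hv : v ≠ 0) : (fixer v).ncard = 3 ↔ hessian v = 0 := by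
  rw [ncard_fixer hv]
  split_ifs <;> simp [*]

theorem eq_zero_of_hessian_eq_zero_of_sexticCovariant_eq_zero (hh : hessian v = 0)
    (hs : sexticCovariant v = 0) : v = 0 := by
  rw [hessian, mul_eq_zero] at hh
  rw [sexticCovariant] at hs
  have hv0 : v 0 = 0 := by
    refine eq_zero_of_pow_eq_zero (n := 6) ?_
    rcases hh with h | h
    · rw [h] at hs
      linear_combination (-1 / 8) * hs
    · linear_combination (1 / 216) * hs + (28 / 216 * v 0 ^ 3 - 1 / 216 * v 1 ^ 3) * h
  have hv1 : v 1 = 0 := by simpa [hv0] using hs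
  ext i
  fin_cases i <;> assumption

theorem ncard_fixer_eq_two_iff (hv : v ≠ 0) : (fixer v).ncard = 2 ↔ sexticCovariant v = 0 := by
  rw [ncard_fixer hv]
  split_ifs with hh hs
  · simpa using mt (eq_zero_of_hessian_eq_zero_of_sexticCovariant_eq_zero hh) hv
  · simpa using hs
  · simpa using hs

theorem exists_eq_smul_of_binaryQuartic_eq_zero (hv : v ≠ 0) (h : binaryQuartic v = 0) :
    ∃ s : ℂ, s ≠ 0 ∧ (v = s • ![0, 1] ∨ ∃ y : ℂ, y ^ 3 = 1 ∧ v = s • ![1, y]) := by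
  obtain ⟨s, hs, rfl | ⟨y, rfl⟩⟩ := exists_eq_smul_or_eq_smul hv
  · exact ⟨s, hs, Or.inl rfl⟩
  · have hy : s ^ 4 * (1 - y ^ 3) = 0 := by
      rw [← h, binaryQuartic]
      simp only [Pi.smul_apply, smul_eq_mul, Matrix.cons_val_zero, Matrix.cons_val_one]
      ring
    rw [mul_eq_zero_iff_left (pow_ne_zero 4 hs), sub_eq_zero] at hy
    exact ⟨s, hs, Or.inr ⟨y, hy.symm, rfl⟩⟩

theorem ncard_fixer_eq_one_of_binaryQuartic_eq_zero (hv : v ≠ 0) (h : binaryQuartic v = 0) :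
    (fixer v).ncard = 1 := by
  obtain ⟨s, hs, rfl | ⟨y, hy, rfl⟩⟩ := exists_eq_smul_of_binaryQuartic_eq_zero hv h
  · rw [fixer_smul hs, ncard_fixer_zero_one]
  · have hy0 : y ≠ 0 := by
      rintro rfl
      norm_num at hy
    rw [fixer_smul hs, ncard_fixer_one_eq hy0, ncard_setOf_pow_four_eq_and_cube_eq, hy]
    norm_num

theorem exists_mulVec_zero_one_eq_smul (hv : v ≠ 0) (h : binaryQuartic v = 0) :
    ∃ M ∈ quarticSymmetries, ∃ s : ℂ, s ≠ 0 ∧ M *ᵥ ![0, 1] = s • v := by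
  obtain ⟨s, hs, rfl | ⟨y, hy, rfl⟩⟩ := exists_eq_smul_of_binaryQuartic_eq_zero hv h
  · exact ⟨1, one_mem _, s⁻¹, inv_ne_zero hs, by
      rw [Matrix.one_mulVec, inv_smul_smul₀ hs]⟩
  · have h9 : (9⁻¹ : ℂ) ≠ 0 := by norm_num
    obtain ⟨⟨a, b⟩, hab⟩ : (coefficientPairs 9⁻¹).Nonempty :=
      Set.nonempty_of_ncard_ne_zero (by rw [ncard_coefficientPairs h9]; norm_num)
    refine ⟨_, offDiagSymmetry_mem hab hy, b * s⁻¹,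
      mul_ne_zero (ne_zero_of_mem_coefficientPairs h9 hab).2 (inv_ne_zero hs), ?_⟩
    rw [offDiagSymmetry_mulVec, mul_smul, inv_smul_smul₀ hs]
    simp [mul_comm]

theorem exists_ne_zero_forall_exists_mulVec_eq_smul {w : Fin 2 → ℂ} (hv : v ≠ 0)
    (hv4 : binaryQuartic v = 0) (hw : w ≠ 0) (hw4 : binaryQuartic w = 0) :
    ∃ c : ℂ, c ≠ 0 ∧ ∀ d : ℂ, d ^ 12 = 1 → ∃ M ∈ quarticSymmetries, M *ᵥ v = (d * c) • w := by
  obtain ⟨A, hA, r, hr, hAr⟩ := exists_mulVec_zero_one_eq_smul hv hv4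
  obtain ⟨B, hB, s, hs, hBs⟩ := exists_mulVec_zero_one_eq_smul hw hw4
  refine ⟨r⁻¹ * s, mul_ne_zero (inv_ne_zero hr) hs, fun d hd => ?_⟩
  have hd0 : d ≠ 0 := by
    rintro rfl
    norm_num at hd
  have hdiag : ((d ^ 3)⁻¹, d) ∈ coefficientPairs 1 :=
    ⟨by rw [inv_pow, ← pow_mul, hd, inv_one], inv_mul_cancel₀ (pow_ne_zero 3 hd0)⟩
  refine ⟨B * diagSymmetry (d ^ 3)⁻¹ d * A⁻¹, mul_mem (mul_mem hB (diagSymmetry_mem hdiag))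
    (inv_mem_quarticSymmetries hA), ?_⟩
  have hAv : A⁻¹ *ᵥ v = r⁻¹ • ![0, 1] := by
    rw [← inv_smul_smul₀ hr v, ← hAr, Matrix.mulVec_smul, Matrix.mulVec_mulVec,
      Matrix.nonsing_inv_mul _ (isUnit_det_of_mem_quarticSymmetries hA), Matrix.one_mulVec]
  have hdv : diagSymmetry (d ^ 3)⁻¹ d *ᵥ ![0, 1] = d • ![0, 1] := by
    rw [diagSymmetry_mulVec]
    simp
  rw [← Matrix.mulVec_mulVec, hAv, Matrix.mulVec_smul, ← Matrix.mulVec_mulVec, hdv,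
    Matrix.mulVec_smul, hBs, smul_smul, smul_smul]
  ring_nf

end Fixer

/-! ### Zeros of binary forms on the projective line -/

section ProjectiveLine

variable {K : Type*} [Field K] {f : (Fin 2 → K) → K} {n : ℕ} {v w : Fin 2 → K}

/-- The projective line over a field. -/
abbrev P1 (K : Type*) [Field K] : Type _ := Projectivization K (Fin 2 → K)

/-- The point with homogeneous coordinates `(1, y)`. -/
def affinePoint (y : K) : P1 K :=
  Projectivization.mk K ![1, y] fun h => one_ne_zero (congrFun h 0)

/-- The point with homogeneous coordinates `(0, 1)`. -/
def infinityPoint : P1 K :=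
  Projectivization.mk K ![0, 1] fun h => one_ne_zero (congrFun h 1)

/-- The zeros of the form `f` on the projective line; for a homogeneous `f` the choice of the
representative does not matter, see `mk_mem_zeroLocus`. -/
def zeroLocus (f : (Fin 2 → K) → K) : Set (P1 K) := {p | f p.rep = 0}

theorem mk_mem_zeroLocus (hf : ∀ (s : K) v, f (s • v) = s ^ n * f v) (hv : v ≠ 0) :
    Projectivization.mk K v hv ∈ zeroLocus f ↔ f v = 0 := by
  obtain ⟨a, ha⟩ := Projectivization.exists_smul_eq_mk_rep K v hv
  rw [zeroLocus, Set.mem_ofPred_eq, ← ha, Units.smul_def, hf,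
    mul_eq_zero_iff_left (pow_ne_zero n a.ne_zero)]

theorem exists_eq_smul_of_mul_eq_mul (hv : v ≠ 0) (h : v 0 * w 1 = v 1 * w 0) :
    ∃ c : K, w = c • v := by
  obtain ⟨s, hs, rfl | ⟨y, rfl⟩⟩ := exists_eq_smul_or_eq_smul hv
  · have hw : w 0 = 0 := by simpa [hs] using h.symm
    refine ⟨w 1 / s, ?_⟩
    ext i
    fin_cases i <;> simp [hs, hw]
  · have hw : w 1 = y * w 0 := by simpa [hs, mul_assoc] using h
    refine ⟨w 0 / s, ?_⟩
    ext i
    fin_cases i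
    · simp [hs]
    · change w 1 = w 0 / s * (s * y)
      rw [hw, ← mul_assoc, div_mul_cancel₀ _ hs, mul_comm]

theorem affinePoint_injective : Function.Injective (affinePoint (K := K)) := by
  intro y z h
  obtain ⟨a, ha⟩ := (Projectivization.mk_eq_mk_iff' ..).1 h
  obtain rfl : a = 1 := by simpa using congrFun ha 0
  simpa using (congrFun ha 1).symm

theorem affinePoint_ne_infinityPoint (y : K) : affinePoint y ≠ infinityPoint := by
  intro h
  obtain ⟨a, ha⟩ := (Projectivization.mk_eq_mk_iff' ..).1 h
  simpa using congrFun ha 0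

theorem eq_infinityPoint_or_exists_eq_affinePoint (p : P1 K) :
    p = infinityPoint ∨ ∃ y, p = affinePoint y := by
  obtain ⟨v, hv⟩ := p
  obtain ⟨s, -, hinf | ⟨y, haff⟩⟩ := exists_eq_smul_or_eq_smul hv
  · exact Or.inl ((Projectivization.mk_eq_mk_iff' ..).2 ⟨s, hinf.symm⟩)
  · exact Or.inr ⟨y, (Projectivization.mk_eq_mk_iff' ..).2 ⟨s, haff.symm⟩⟩

theorem zeroLocus_sdiff_infinityPoint (hf : ∀ (s : K) v, f (s • v) = s ^ n * f v) :
    zeroLocus f \ {infinityPoint} = affinePoint '' {y | f ![1, y] = 0} := by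
  ext p
  constructor
  · rintro ⟨hp, hinf⟩
    obtain rfl | ⟨y, rfl⟩ := eq_infinityPoint_or_exists_eq_affinePoint p
    · exact absurd rfl hinf
    · exact ⟨y, (mk_mem_zeroLocus hf _).1 hp, rfl⟩
  · rintro ⟨y, hy, rfl⟩
    exact ⟨(mk_mem_zeroLocus hf _).2 hy, affinePoint_ne_infinityPoint y⟩

theorem ncard_zeroLocus_of_ne_zero (hf : ∀ (s : K) v, f (s • v) = s ^ n * f v)
    (hinf : f ![0, 1] ≠ 0) : (zeroLocus f).ncard = {y | f ![1, y] = 0}.ncard := by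
  have hnotMem : infinityPoint ∉ zeroLocus f := mt (mk_mem_zeroLocus hf _).1 hinf
  rw [← Set.sdiff_singleton_eq_self hnotMem, zeroLocus_sdiff_infinityPoint hf,
    Set.ncard_image_of_injective _ affinePoint_injective]

theorem ncard_zeroLocus_of_eq_zero (hf : ∀ (s : K) v, f (s • v) = s ^ n * f v)
    (hinf : f ![0, 1] = 0) (hfin : {y | f ![1, y] = 0}.Finite) :
    (zeroLocus f).ncard = {y | f ![1, y] = 0}.ncard + 1 := by
  have hmem : infinityPoint ∈ zeroLocus f := (mk_mem_zeroLocus hf _).2 hinf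
  rw [← Set.insert_sdiff_self_of_mem hmem, zeroLocus_sdiff_infinityPoint hf,
    Set.ncard_insert_of_notMem _ (hfin.image _),
    Set.ncard_image_of_injective _ affinePoint_injective]
  rintro ⟨y, -, hy⟩
  exact affinePoint_ne_infinityPoint y hy

end ProjectiveLine

section Covariants

theorem binaryQuartic_smul (s : ℂ) (v : Fin 2 → ℂ) :
    binaryQuartic (s • v) = s ^ 4 * binaryQuartic v := by
  simp only [binaryQuartic, Pi.smul_apply, smul_eq_mul]
  ring

theorem hessian_smul (s : ℂ) (v : Fin 2 → ℂ) : hessian (s • v) = s ^ 4 * hessian v := by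
  simp only [hessian, Pi.smul_apply, smul_eq_mul]
  ring

theorem sexticCovariant_smul (s : ℂ) (v : Fin 2 → ℂ) :
    sexticCovariant (s • v) = s ^ 6 * sexticCovariant v := by
  simp only [sexticCovariant, Pi.smul_apply, smul_eq_mul]
  ring

theorem ncard_zeroLocus_binaryQuartic : (zeroLocus binaryQuartic).ncard = 4 := by
  have hroots : {y | binaryQuartic ![1, y] = 0} = {y | y ^ 3 = 1} := by
    ext y
    simp [binaryQuartic, sub_eq_zero, eq_comm (a := (1 : ℂ))]
  rw [ncard_zeroLocus_of_eq_zero binaryQuartic_smul (by simp [binaryQuartic])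
    (hroots ▸ finite_setOf_pow_eq three_ne_zero 1), hroots, ncard_setOf_pow_eq one_ne_zero]

theorem ncard_zeroLocus_hessian : (zeroLocus hessian).ncard = 4 := by
  have hroots : {y | hessian ![1, y] = 0} = insert 0 {y | y ^ 3 = -8} := by
    ext y
    simp [hessian, add_eq_zero_iff_eq_neg]
  rw [ncard_zeroLocus_of_ne_zero hessian_smul (by simp [hessian]), hroots,
    Set.ncard_insert_of_notMem (by simp) (finite_setOf_pow_eq three_ne_zero _),
    ncard_setOf_pow_eq (by norm_num)]

theorem ncard_zeroLocus_sexticCovariant : (zeroLocus sexticCovariant).ncard = 6 := by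
  obtain ⟨s, hs⟩ := IsAlgClosed.exists_pow_nat_eq (108 : ℂ) two_pos
  have hroots : {y | sexticCovariant ![1, y] = 0} =
      {y | y ^ 3 = 10 + s} ∪ {y | y ^ 3 = 10 - s} := by
    ext y
    have hfactor : sexticCovariant ![1, y] = (y ^ 3 - (10 + s)) * (y ^ 3 - (10 - s)) := by
      simp only [sexticCovariant, Matrix.cons_val_zero, Matrix.cons_val_one]
      linear_combination hs
    simp only [Set.mem_ofPred_eq, Set.mem_union, hfactor, mul_eq_zero, sub_eq_zero]
  have hs0 : s ≠ 0 := by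
    rintro rfl
    norm_num at hs
  obtain ⟨hplus, hminus⟩ : 10 + s ≠ 0 ∧ 10 - s ≠ 0 := by
    rw [← mul_ne_zero_iff, show (10 + s) * (10 - s) = 100 - s ^ 2 by ring, hs]
    norm_num
  have hdisj : Disjoint {y : ℂ | y ^ 3 = 10 + s} {y | y ^ 3 = 10 - s} := by
    refine Set.disjoint_left.2 fun y (hy : y ^ 3 = _) (hy' : y ^ 3 = _) => hs0 ?_
    linear_combination (hy' - hy) / 2
  rw [ncard_zeroLocus_of_ne_zero sexticCovariant_smul (by simp [sexticCovariant]), hroots,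
    Set.ncard_union_eq hdisj (finite_setOf_pow_eq three_ne_zero _)
      (finite_setOf_pow_eq three_ne_zero _), ncard_setOf_pow_eq hplus, ncard_setOf_pow_eq hminus]

end Covariants

/-! ### The lines on the Schur quartic -/

section Coordinates

/-- The projection of `ℂ⁴` to the first two homogeneous coordinates. -/
def head : V →ₗ[ℂ] (Fin 2 → ℂ) := LinearMap.funLeft ℂ ℂ ![0, 1]

/-- The projection of `ℂ⁴` to the last two homogeneous coordinates. -/
def tail : V →ₗ[ℂ] (Fin 2 → ℂ) := LinearMap.funLeft ℂ ℂ ![2, 3]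

/-- The vector with given first two and last two coordinates. -/
def join (v w : Fin 2 → ℂ) : V := ![v 0, v 1, w 0, w 1]

theorem head_apply (x : V) : head x = ![x 0, x 1] := by
  ext i
  fin_cases i <;> rfl

theorem tail_apply (x : V) : tail x = ![x 2, x 3] := by
  ext i
  fin_cases i <;> rfl

@[simp] theorem head_join (v w : Fin 2 → ℂ) : head (join v w) = v := by
  ext i
  fin_cases i <;> rfl

@[simp] theorem tail_join (v w : Fin 2 → ℂ) : tail (join v w) = w := by
  ext i
  fin_cases i <;> rfl

theorem ext_head_tail {x y : V} (hhead : head x = head y) (htail : tail x = tail y) : x = y := by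
  ext i
  fin_cases i
  exacts [congrFun hhead 0, congrFun hhead 1, congrFun htail 0, congrFun htail 1]

theorem join_head_tail (x : V) : join (head x) (tail x) = x :=
  ext_head_tail (head_join _ _) (tail_join _ _)

theorem head_ne_zero_or_tail_ne_zero {x : V} (hx : x ≠ 0) : head x ≠ 0 ∨ tail x ≠ 0 := by
  by_contra! h
  exact hx (ext_head_tail (h.1.trans (map_zero head).symm) (h.2.trans (map_zero tail).symm))

theorem join_ne_zero_left {v : Fin 2 → ℂ} (hv : v ≠ 0) (w : Fin 2 → ℂ) : join v w ≠ 0 :=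
  fun h => hv (by rw [← head_join v w, h, map_zero])

theorem join_ne_zero_right (v : Fin 2 → ℂ) {w : Fin 2 → ℂ} (hw : w ≠ 0) : join v w ≠ 0 :=
  fun h => hw (by rw [← tail_join v w, h, map_zero])

theorem mem_axisA {x : V} : x ∈ axisA ↔ tail x = 0 := by
  simp [axisA, tail_apply]

theorem mem_axisB {x : V} : x ∈ axisB ↔ head x = 0 := by
  simp [axisB, head_apply]

theorem eval_schurQuartic (x : V) :
    eval x schurQuartic = binaryQuartic (head x) - binaryQuartic (tail x) := by
  simp only [schurQuartic, binaryQuartic, head_apply, tail_apply, map_add, map_sub, map_mul,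
    map_pow, eval_X, Matrix.cons_val_zero, Matrix.cons_val_one]
  ring

end Coordinates

section Smoothness

variable (v : V)

theorem eval_pderiv_zero_schurQuartic :
    eval v (pderiv 0 schurQuartic) = 4 * v 0 ^ 3 - v 1 ^ 3 := by
  simp [schurQuartic, pderiv_X]

theorem eval_pderiv_one_schurQuartic :
    eval v (pderiv 1 schurQuartic) = -(3 * v 0 * v 1 ^ 2) := by
  simp [schurQuartic, pderiv_X]
  ring

theorem eval_pderiv_two_schurQuartic :
    eval v (pderiv 2 schurQuartic) = v 3 ^ 3 - 4 * v 2 ^ 3 := by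
  simp [schurQuartic, pderiv_X]
  ring

theorem eval_pderiv_three_schurQuartic :
    eval v (pderiv 3 schurQuartic) = 3 * v 2 * v 3 ^ 2 := by
  simp [schurQuartic, pderiv_X]
  ring

theorem eq_zero_of_four_mul_cube_eq {a b : ℂ} (h : 4 * a ^ 3 = b ^ 3) (h' : a * b ^ 2 = 0) :
    a = 0 ∧ b = 0 := by
  rcases mul_eq_zero.1 h' with rfl | hb
  · exact ⟨rfl, by simpa using h.symm⟩
  · obtain rfl : b = 0 := by simpa using hb
    exact ⟨by simpa using h, rfl⟩

theorem isHomogeneous_schurQuartic : schurQuartic.IsHomogeneous 4 := by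
  have hX (i : Fin 4) : (X i : MvPolynomial (Fin 4) ℂ).IsHomogeneous 1 := isHomogeneous_X _ _
  exact ((((hX 0).pow 4).sub ((hX 0).mul ((hX 1).pow 3))).sub ((hX 2).pow 4)).add
    ((hX 2).mul ((hX 3).pow 3))

theorem isSmoothQuartic_schurQuartic : IsSmoothQuartic schurQuartic := by
  refine ⟨fun h => ?_, isHomogeneous_schurQuartic, fun v hv _ => ?_⟩
  · simpa [schurQuartic] using congrArg (eval ![1, 0, 0, 0]) h
  · by_contra! hsing
    obtain ⟨h0, h1⟩ : v 0 = 0 ∧ v 1 = 0 := by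
      refine eq_zero_of_four_mul_cube_eq ?_ ?_
      · linear_combination (eval_pderiv_zero_schurQuartic v).symm.trans (hsing 0)
      · linear_combination (-1 / 3) * (eval_pderiv_one_schurQuartic v).symm.trans (hsing 1)
    obtain ⟨h2, h3⟩ : v 2 = 0 ∧ v 3 = 0 := by
      refine eq_zero_of_four_mul_cube_eq ?_ ?_
      · linear_combination -(eval_pderiv_two_schurQuartic v).symm.trans (hsing 2)
      · linear_combination (1 / 3) * (eval_pderiv_three_schurQuartic v).symm.trans (hsing 3)
    refine hv (funext fun i => ?_)
    fin_cases i <;> assumption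

end Smoothness

section GraphLine

variable {M : Matrix (Fin 2) (Fin 2) ℂ} {L : Submodule ℂ V} {x : V}

/-- The parametrization `v ↦ (v, Mv)` of the graph of a matrix. -/
def graphMap (M : Matrix (Fin 2) (Fin 2) ℂ) : (Fin 2 → ℂ) →ₗ[ℂ] V where
  toFun v := join v (M *ᵥ v)
  map_add' v w := ext_head_tail (by simp) (by simp [Matrix.mulVec_add])
  map_smul' c v := ext_head_tail (by simp) (by simp [Matrix.mulVec_smul])

/-- The line in projective space that is the graph of a matrix. -/
def graphLine (M : Matrix (Fin 2) (Fin 2) ℂ) : Submodule ℂ V := LinearMap.range (graphMap M)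

theorem graphMap_apply (v : Fin 2 → ℂ) : graphMap M v = join v (M *ᵥ v) := rfl

theorem graphMap_injective : Function.Injective (graphMap M) :=
  Function.LeftInverse.injective (g := head) fun _ => head_join _ _

theorem mem_graphLine : x ∈ graphLine M ↔ tail x = M *ᵥ head x := by
  constructor
  · rintro ⟨v, rfl⟩
    rw [graphMap_apply, head_join, tail_join]
  · intro h
    exact ⟨head x, by rw [graphMap_apply, ← h, join_head_tail]⟩

theorem join_mem_graphLine {v w : Fin 2 → ℂ} : join v w ∈ graphLine M ↔ w = M *ᵥ v := by
  rw [mem_graphLine, head_join, tail_join]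

theorem finrank_graphLine : Module.finrank ℂ (graphLine M) = 2 := by
  rw [graphLine, LinearMap.finrank_range_of_inj graphMap_injective, Module.finrank_fin_fun]

theorem graphLine_injective : Function.Injective graphLine := fun _ _ h =>
  Matrix.ext_of_mulVec_single fun _ => join_mem_graphLine.1 (h ▸ join_mem_graphLine.2 rfl)

theorem graphLine_mem_linesOn (hM : M ∈ quarticSymmetries) :
    graphLine M ∈ linesOn schurQuartic := by
  refine ⟨finrank_graphLine, fun x hx => ?_⟩
  rw [eval_schurQuartic, mem_graphLine.1 hx, hM, sub_self]

theorem graphLine_inf_axisB : graphLine M ⊓ axisB = ⊥ := by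
  refine (Submodule.eq_bot_iff _).2 fun x ⟨hx, hxB⟩ => ?_
  by_contra hx0
  have hhead : head x = 0 := mem_axisB.1 hxB
  have htail : tail x = 0 := by rw [mem_graphLine.1 hx, hhead, Matrix.mulVec_zero]
  exact (head_ne_zero_or_tail_ne_zero hx0).elim (· hhead) (· htail)

theorem exists_graphLine_eq (hL : Module.finrank ℂ L = 2) (hB : L ⊓ axisB = ⊥) :
    ∃ M, graphLine M = L := by
  have hinj : Function.Injective (head.domRestrict L) := by
    refine (injective_iff_map_eq_zero _).2 fun x hx => Subtype.ext ?_
    exact (Submodule.mem_bot ℂ).1 (hB ▸ ⟨x.2, mem_axisB.2 hx⟩)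
  have hsurj : Function.Surjective (head.domRestrict L) :=
    (LinearMap.injective_iff_surjective_of_finrank_eq_finrank (by simp [hL])).1 hinj
  let e := LinearEquiv.ofBijective (head.domRestrict L) ⟨hinj, hsurj⟩
  let slope : (Fin 2 → ℂ) →ₗ[ℂ] (Fin 2 → ℂ) := tail ∘ₗ L.subtype ∘ₗ e.symm.toLinearMap
  refine ⟨LinearMap.toMatrix' slope, (Submodule.eq_of_le_of_finrank_eq (fun x hx => ?_)
    (hL.trans finrank_graphLine.symm)).symm⟩
  have hx' : e.symm (head x) = ⟨x, hx⟩ := (LinearEquiv.symm_apply_eq e).2 rfl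
  rw [mem_graphLine, LinearMap.toMatrix'_mulVec]
  simp [slope, hx']

theorem mem_quarticSymmetries_of_graphLine_mem (h : graphLine M ∈ linesOn schurQuartic) :
    M ∈ quarticSymmetries := by
  intro v
  have hv := h.2 _ (join_mem_graphLine.2 rfl : join v (M *ᵥ v) ∈ graphLine M)
  rw [eval_schurQuartic, head_join, tail_join] at hv
  exact (sub_eq_zero.1 hv).symm

end GraphLine

section FirstKind

variable {p q : P1 ℂ} {L : Submodule ℂ V} {x : V}

/-- The line that joins the point `p` of the axis `x₂ = x₃ = 0` to the point `q` of the axis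
`x₀ = x₁ = 0`. -/
def crossLine (p q : P1 ℂ) : Submodule ℂ V := p.submodule.comap head ⊓ q.submodule.comap tail

theorem mem_crossLine : x ∈ crossLine p q ↔ head x ∈ p.submodule ∧ tail x ∈ q.submodule := Iff.rfl

theorem finrank_crossLine : Module.finrank ℂ (crossLine p q) = 2 := by
  let e : crossLine p q ≃ₗ[ℂ] p.submodule × q.submodule :=
    { toFun x := (⟨head x, x.2.1⟩, ⟨tail x, x.2.2⟩)
      map_add' _ _ := rfl
      map_smul' _ _ := rfl
      invFun vw := ⟨join vw.1 vw.2, by simp [mem_crossLine]⟩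
      left_inv x := Subtype.ext (join_head_tail x)
      right_inv vw := Prod.ext (Subtype.ext (head_join _ _)) (Subtype.ext (tail_join _ _)) }
  rw [e.finrank_eq, Module.finrank_prod, p.finrank_submodule, q.finrank_submodule]

theorem binaryQuartic_zero : binaryQuartic 0 = 0 := by
  simp [binaryQuartic]

theorem mem_zeroLocus_binaryQuartic_iff :
    p ∈ zeroLocus binaryQuartic ↔ ∀ v ∈ p.submodule, binaryQuartic v = 0 := by
  obtain ⟨v, hv⟩ := p
  refine (mk_mem_zeroLocus binaryQuartic_smul hv).trans ⟨fun h w hw => ?_, fun h => h v ?_⟩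
  · obtain ⟨c, rfl⟩ := Submodule.mem_span_singleton.1 hw
    rw [binaryQuartic_smul, h, mul_zero]
  · exact Submodule.mem_span_singleton_self v

theorem crossLine_mem_linesOn (hp : p ∈ zeroLocus binaryQuartic)
    (hq : q ∈ zeroLocus binaryQuartic) : crossLine p q ∈ linesOn schurQuartic := by
  rw [mem_zeroLocus_binaryQuartic_iff] at hp hq
  exact ⟨finrank_crossLine, fun x hx => by
    rw [eval_schurQuartic, hp _ hx.1, hq _ hx.2, sub_zero]⟩

theorem crossLine_mem_firstKind (hp : p ∈ zeroLocus binaryQuartic)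
    (hq : q ∈ zeroLocus binaryQuartic) : crossLine p q ∈ firstKind := by
  have hprep : p.rep ∈ p.submodule := p.submodule_eq ▸ Submodule.mem_span_singleton_self _
  have hqrep : q.rep ∈ q.submodule := q.submodule_eq ▸ Submodule.mem_span_singleton_self _
  refine ⟨crossLine_mem_linesOn hp hq, (Submodule.ne_bot_iff _).2 ⟨join p.rep 0, ⟨?_, ?_⟩,
    join_ne_zero_left p.rep_nonzero _⟩, (Submodule.ne_bot_iff _).2 ⟨join 0 q.rep, ⟨?_, ?_⟩,
    join_ne_zero_right _ q.rep_nonzero⟩⟩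
  · simpa [mem_crossLine] using hprep
  · exact mem_axisA.2 (tail_join _ _)
  · simpa [mem_crossLine] using hqrep
  · exact mem_axisB.2 (head_join _ _)

theorem exists_crossLine_eq (hL : L ∈ firstKind) :
    ∃ p ∈ zeroLocus binaryQuartic, ∃ q ∈ zeroLocus binaryQuartic, crossLine p q = L := by
  obtain ⟨hL, hA, hB⟩ := hL
  obtain ⟨x, ⟨hxL, hxA⟩, hx0⟩ := (Submodule.ne_bot_iff _).1 hA
  obtain ⟨y, ⟨hyL, hyB⟩, hy0⟩ := (Submodule.ne_bot_iff _).1 hB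
  have htx : tail x = 0 := mem_axisA.1 hxA
  have hhy : head y = 0 := mem_axisB.1 hyB
  have hhx : head x ≠ 0 := (head_ne_zero_or_tail_ne_zero hx0).resolve_right (· htx)
  have hty : tail y ≠ 0 := (head_ne_zero_or_tail_ne_zero hy0).resolve_left (· hhy)
  refine ⟨.mk ℂ (head x) hhx, ?_, .mk ℂ (tail y) hty, ?_,
    Submodule.eq_of_le_of_finrank_eq (fun z hz => ?_) (finrank_crossLine.trans hL.1.symm)⟩
  · rw [mk_mem_zeroLocus binaryQuartic_smul]
    simpa [eval_schurQuartic, htx, binaryQuartic_zero] using hL.2 x hxL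
  · rw [mk_mem_zeroLocus binaryQuartic_smul]
    simpa [eval_schurQuartic, hhy, binaryQuartic_zero] using hL.2 y hyL
  · simp only [mem_crossLine, Projectivization.submodule_mk, Submodule.mem_span_singleton] at hz
    obtain ⟨⟨c, hc⟩, d, hd⟩ := hz
    have hz : z = c • x + d • y :=
      ext_head_tail (by simp [hhy, hc]) (by simp [htx, hd])
    exact hz ▸ L.add_mem (L.smul_mem c hxL) (L.smul_mem d hyL)

theorem firstKind_eq :
    firstKind = Set.image2 crossLine (zeroLocus binaryQuartic) (zeroLocus binaryQuartic) := by
  ext L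
  constructor
  · exact exists_crossLine_eq
  · rintro ⟨p, hp, q, hq, rfl⟩
    exact crossLine_mem_firstKind hp hq

theorem map_head_crossLine : (crossLine p q).map head = p.submodule := by
  refine le_antisymm (Submodule.map_le_iff_le_comap.2 inf_le_left) fun v hv => ?_
  exact ⟨join v 0, by simpa [mem_crossLine] using hv, head_join _ _⟩

theorem map_tail_crossLine : (crossLine p q).map tail = q.submodule := by
  refine le_antisymm (Submodule.map_le_iff_le_comap.2 inf_le_right) fun w hw => ?_
  exact ⟨join 0 w, by simpa [mem_crossLine] using hw, tail_join _ _⟩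

theorem crossLine_injective : Function.Injective (Function.uncurry crossLine) := by
  rintro ⟨p, q⟩ ⟨p', q'⟩ (h : crossLine p q = crossLine p' q')
  refine Prod.ext (Projectivization.submodule_injective ?_)
    (Projectivization.submodule_injective ?_)
  · rw [← map_head_crossLine, h, map_head_crossLine]
  · rw [← map_tail_crossLine, h, map_tail_crossLine]

theorem ncard_firstKind : firstKind.ncard = 16 := by
  rw [firstKind_eq, ← Set.image_uncurry_prod, Set.ncard_image_of_injective _ crossLine_injective,
    Set.ncard_prod, ncard_zeroLocus_binaryQuartic]

theorem finite_firstKind : firstKind.Finite :=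
  Set.finite_of_ncard_ne_zero (by rw [ncard_firstKind]; norm_num)

end FirstKind

section SecondKind

variable {L : Submodule ℂ V} {x y : V}

theorem exists_tail_eq_smul (hL : L ∈ linesOn schurQuartic) (hx : x ∈ L) (hhead : head x = 0)
    (hx0 : x ≠ 0) (hy : y ∈ L) : ∃ c : ℂ, tail y = c • tail x := by
  have h0 : x 0 = 0 := congrFun hhead 0
  have h1 : x 1 = 0 := congrFun hhead 1
  -- The tangent plane at `x` contains `L` and is defined by an equation in `x₂` and `x₃` only.
  have htangent {z : V} (hz : z ∈ L) :
      (x 3 ^ 3 - 4 * x 2 ^ 3) * z 2 + 3 * x 2 * x 3 ^ 2 * z 3 = 0 := by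
    simpa [tangentSpace, Fin.sum_univ_four, eval_pderiv_zero_schurQuartic,
      eval_pderiv_one_schurQuartic, eval_pderiv_two_schurQuartic, eval_pderiv_three_schurQuartic,
      h0, h1] using le_tangentSpace hL.2 hx hz
  obtain ⟨i, hi⟩ := isSmoothQuartic_schurQuartic.2.2 x hx0 (hL.2 x hx)
  have hdet : x 2 * y 3 = x 3 * y 2 := by
    fin_cases i
    · simp [eval_pderiv_zero_schurQuartic, h0, h1] at hi
    · simp [eval_pderiv_one_schurQuartic, h0] at hi
    · refine mul_left_cancel₀ ((eval_pderiv_two_schurQuartic x).symm.trans_ne hi) ?_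
      linear_combination y 3 * htangent hx - x 3 * htangent hy
    · refine mul_left_cancel₀ ((eval_pderiv_three_schurQuartic x).symm.trans_ne hi) ?_
      linear_combination x 2 * htangent hy - y 2 * htangent hx
  exact exists_eq_smul_of_mul_eq_mul
    ((head_ne_zero_or_tail_ne_zero hx0).resolve_left (· hhead)) hdet

theorem inf_axisA_ne_bot (hL : L ∈ linesOn schurQuartic) (hB : L ⊓ axisB ≠ ⊥) :
    L ⊓ axisA ≠ ⊥ := by
  obtain ⟨x, ⟨hxL, hxB⟩, hx0⟩ := (Submodule.ne_bot_iff _).1 hB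
  have htail := (head_ne_zero_or_tail_ne_zero hx0).resolve_left (· (mem_axisB.1 hxB))
  intro hA
  let tailOnL : L →ₗ[ℂ] (ℂ ∙ tail x) := (tail.domRestrict L).codRestrict _ fun y =>
    Submodule.mem_span_singleton.2 <| by
      obtain ⟨c, hc⟩ := exists_tail_eq_smul hL hxL (mem_axisB.1 hxB) hx0 y.2
      exact ⟨c, hc.symm⟩
  have hinj : Function.Injective tailOnL := by
    refine (injective_iff_map_eq_zero _).2 fun y hy => Subtype.ext ?_
    exact (Submodule.mem_bot ℂ).1 (hA ▸ ⟨y.2, mem_axisA.2 (congrArg Subtype.val hy)⟩)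
  have hrank := LinearMap.finrank_le_finrank_of_injective hinj
  rw [hL.1, finrank_span_singleton htail] at hrank
  omega

theorem secondKind_eq : secondKind = graphLine '' quarticSymmetries := by
  ext L
  constructor
  · rintro ⟨hL, hfirst⟩
    have hB : L ⊓ axisB = ⊥ := by_contra fun h => hfirst ⟨hL, inf_axisA_ne_bot hL h, h⟩
    obtain ⟨M, rfl⟩ := exists_graphLine_eq hL.1 hB
    exact ⟨M, mem_quarticSymmetries_of_graphLine_mem hL, rfl⟩
  · rintro ⟨M, hM, rfl⟩
    exact ⟨graphLine_mem_linesOn hM, fun h => h.2.2 graphLine_inf_axisB⟩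

theorem ncard_secondKind : secondKind.ncard = 48 := by
  rw [secondKind_eq, Set.ncard_image_of_injective _ graphLine_injective, ncard_quarticSymmetries]

theorem finite_secondKind : secondKind.Finite :=
  Set.finite_of_ncard_ne_zero (by rw [ncard_secondKind]; norm_num)

theorem firstKind_union_secondKind : firstKind ∪ secondKind = linesOn schurQuartic :=
  Set.union_sdiff_cancel fun _ h => h.1

theorem disjoint_firstKind_secondKind : Disjoint firstKind secondKind :=
  Set.disjoint_sdiff_right

theorem ncard_linesOn_schurQuartic : (linesOn schurQuartic).ncard = 64 := by
  rw [← firstKind_union_secondKind, Set.ncard_union_eq disjoint_firstKind_secondKind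
    finite_firstKind finite_secondKind, ncard_firstKind, ncard_secondKind]

theorem finite_linesOn_schurQuartic : (linesOn schurQuartic).Finite :=
  Set.finite_of_ncard_ne_zero (by rw [ncard_linesOn_schurQuartic]; norm_num)

end SecondKind

/-! ### Multiplicities of the points on the lines -/

section Multiplicities

variable {M : Matrix (Fin 2) (Fin 2) ℂ} {L : Submodule ℂ V} {x : V} {p : P3} {q r : P1 ℂ}

theorem mk_eq_of_mem_submodule {K W : Type*} [Field K] [AddCommGroup W] [Module K W]
    {p : Projectivization K W} {v : W} (hv : v ≠ 0) (h : v ∈ p.submodule) :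
    Projectivization.mk K v hv = p := by
  obtain ⟨w, hw⟩ := p
  exact (Projectivization.mk_eq_mk_iff' ..).2 (Submodule.mem_span_singleton.1 h)

/-- The point `[v : Mv]` of the graph of `M` over the point `[v]` of the projective line. -/
def graphPoint (M : Matrix (Fin 2) (Fin 2) ℂ) : P1 ℂ → P3 :=
  Projectivization.map (graphMap M) graphMap_injective

theorem graphPoint_injective : Function.Injective (graphPoint M) :=
  Projectivization.map_injective _ _

theorem range_graphPoint : Set.range (graphPoint M) = {p | p.submodule ≤ graphLine M} := by
  ext p
  constructor
  · rintro ⟨⟨v, hv⟩, rfl⟩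
    exact (submodule_mk_le _).2 (LinearMap.mem_range_self _ v)
  · obtain ⟨x, hx⟩ := p
    intro h
    obtain ⟨v, rfl⟩ := (submodule_mk_le hx).1 h
    exact ⟨.mk ℂ v fun hv => hx (by rw [hv, map_zero]), rfl⟩

theorem setOf_le_graphLine_and (P : P3 → Prop) :
    {p | p.submodule ≤ graphLine M ∧ P p} = graphPoint M '' {q | P (graphPoint M q)} := by
  rw [← Set.preimage_ofPred_eq, Set.image_preimage_eq_range_inter, range_graphPoint]
  rfl

theorem multiplicity_mk {C : Set (Submodule ℂ V)} (hx : x ≠ 0) :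
    multiplicity C (.mk ℂ x hx) = {L ∈ C | x ∈ L}.ncard := by
  simp only [multiplicity, submodule_mk_le]

theorem multiplicity_secondKind_graphPoint (hM : M ∈ quarticSymmetries) {v : Fin 2 → ℂ}
    (hv : v ≠ 0) : multiplicity secondKind (graphPoint M (.mk ℂ v hv)) = (fixer v).ncard := by
  have hlines : {L ∈ secondKind | graphMap M v ∈ L} =
      graphLine '' {N ∈ quarticSymmetries | N *ᵥ v = M *ᵥ v} := by
    rw [secondKind_eq]
    ext L
    constructor
    · rintro ⟨⟨N, hN, rfl⟩, hv⟩
      exact ⟨N, ⟨hN, (join_mem_graphLine.1 hv).symm⟩, rfl⟩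
    · rintro ⟨N, ⟨hN, hNv⟩, rfl⟩
      exact ⟨⟨N, hN, rfl⟩, join_mem_graphLine.2 hNv.symm⟩
  rw [graphPoint, Projectivization.map_mk, multiplicity_mk, hlines,
    Set.ncard_image_of_injective _ graphLine_injective, ncard_setOf_mulVec_eq hM]

theorem multiplicity_secondKind_le (p : P3) : multiplicity secondKind p ≤ 3 := by
  rcases Nat.eq_zero_or_pos (multiplicity secondKind p) with h | h
  · omega
  obtain ⟨L, hL, hp⟩ := exists_of_one_le_multiplicity h
  rw [secondKind_eq] at hL
  obtain ⟨M, hM, rfl⟩ := hL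
  obtain ⟨⟨v, hv⟩, rfl⟩ := range_graphPoint.symm.subset hp
  exact (multiplicity_secondKind_graphPoint hM hv).trans_le (ncard_fixer_le hv)

theorem ncard_triple_points (hL : L ∈ secondKind) :
    {p : P3 | p.submodule ≤ L ∧ multiplicity secondKind p = 3}.ncard = 4 := by
  rw [secondKind_eq] at hL
  obtain ⟨M, hM, rfl⟩ := hL
  rw [setOf_le_graphLine_and, Set.ncard_image_of_injective _ graphPoint_injective,
    ← ncard_zeroLocus_hessian]
  congr 1
  ext ⟨v, hv⟩
  exact (multiplicity_secondKind_graphPoint hM hv ▸ ncard_fixer_eq_three_iff hv).trans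
    (mk_mem_zeroLocus hessian_smul hv).symm

theorem ncard_double_points (hL : L ∈ secondKind) :
    {p : P3 | p.submodule ≤ L ∧ multiplicity secondKind p = 2}.ncard = 6 := by
  rw [secondKind_eq] at hL
  obtain ⟨M, hM, rfl⟩ := hL
  rw [setOf_le_graphLine_and, Set.ncard_image_of_injective _ graphPoint_injective,
    ← ncard_zeroLocus_sexticCovariant]
  congr 1
  ext ⟨v, hv⟩
  exact (multiplicity_secondKind_graphPoint hM hv ▸ ncard_fixer_eq_two_iff hv).trans
    (mk_mem_zeroLocus sexticCovariant_smul hv).symm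

theorem multiplicity_firstKind_le_four (p : P3) : multiplicity firstKind p ≤ 4 := by
  have hfin : (zeroLocus binaryQuartic).Finite :=
    Set.finite_of_ncard_ne_zero (by rw [ncard_zeroLocus_binaryQuartic]; norm_num)
  have hpencil (g : P1 ℂ → Submodule ℂ V) (hg : {L ∈ firstKind | p.submodule ≤ L} ⊆
      g '' zeroLocus binaryQuartic) : multiplicity firstKind p ≤ 4 :=
    (Set.ncard_le_ncard hg (hfin.image g)).trans
      ((Set.ncard_image_le hfin).trans_eq ncard_zeroLocus_binaryQuartic)
  obtain ⟨x, hx⟩ := p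
  rcases head_ne_zero_or_tail_ne_zero hx with hhead | htail
  · refine hpencil (crossLine (.mk ℂ (head x) hhead)) fun L ⟨hL, hxL⟩ => ?_
    obtain ⟨q, -, r, hr, rfl⟩ := exists_crossLine_eq hL
    exact ⟨r, hr, by rw [mk_eq_of_mem_submodule hhead ((submodule_mk_le hx).1 hxL).1]⟩
  · refine hpencil (crossLine · (.mk ℂ (tail x) htail)) fun L ⟨hL, hxL⟩ => ?_
    obtain ⟨q, hq, r, -, rfl⟩ := exists_crossLine_eq hL
    exact ⟨q, hq, by rw [mk_eq_of_mem_submodule htail ((submodule_mk_le hx).1 hxL).2]⟩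

theorem multiplicity_firstKind_le_one (hx : x ≠ 0) (hhead : head x ≠ 0) (htail : tail x ≠ 0) :
    multiplicity firstKind (.mk ℂ x hx) ≤ 1 := by
  have hsub : {L ∈ firstKind | x ∈ L} ⊆
      {crossLine (.mk ℂ (head x) hhead) (.mk ℂ (tail x) htail)} := by
    rintro L ⟨hL, hxL⟩
    obtain ⟨q, -, r, -, rfl⟩ := exists_crossLine_eq hL
    rw [Set.mem_singleton_iff, mk_eq_of_mem_submodule hhead hxL.1,
      mk_eq_of_mem_submodule htail hxL.2]
  rw [multiplicity_mk]
  exact (Set.ncard_le_ncard hsub).trans_eq (Set.ncard_singleton _)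

theorem mulVec_ne_zero (hM : M ∈ quarticSymmetries) {v : Fin 2 → ℂ} (hv : v ≠ 0) :
    M *ᵥ v ≠ 0 := fun h => hv <|
  Matrix.mulVec_injective_of_isUnit ((Matrix.isUnit_iff_isUnit_det M).2
    (isUnit_det_of_mem_quarticSymmetries hM)) (h.trans (Matrix.mulVec_zero M).symm)

theorem multiplicity_eq_one_of_mixed (hfirst : 1 ≤ multiplicity firstKind p)
    (hsecond : 1 ≤ multiplicity secondKind p) :
    multiplicity firstKind p = 1 ∧ multiplicity secondKind p = 1 := by
  obtain ⟨K, hK, hpK⟩ := exists_of_one_le_multiplicity hfirst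
  obtain ⟨L, hL, hpL⟩ := exists_of_one_le_multiplicity hsecond
  obtain ⟨q, hq, r, -, rfl⟩ := exists_crossLine_eq hK
  rw [secondKind_eq] at hL
  obtain ⟨M, hM, rfl⟩ := hL
  obtain ⟨⟨v, hv⟩, rfl⟩ := range_graphPoint.symm.subset hpL
  constructor
  · refine le_antisymm (multiplicity_firstKind_le_one _ ?_ ?_) hfirst
    · rwa [graphMap_apply, head_join]
    · rw [graphMap_apply, tail_join]
      exact mulVec_ne_zero hM hv
  · refine (multiplicity_secondKind_graphPoint hM hv).trans
      (ncard_fixer_eq_one_of_binaryQuartic_eq_zero hv ?_)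
    refine mem_zeroLocus_binaryQuartic_iff.1 hq v ?_
    exact head_join v _ ▸ ((submodule_mk_le _).1 hpK).1

theorem ncard_mixed_points_le_of_mem_secondKind (hL : L ∈ secondKind) :
    {p : P3 | p.submodule ≤ L ∧ 1 ≤ multiplicity firstKind p}.ncard ≤ 4 := by
  rw [secondKind_eq] at hL
  obtain ⟨M, -, rfl⟩ := hL
  rw [setOf_le_graphLine_and, Set.ncard_image_of_injective _ graphPoint_injective,
    ← ncard_zeroLocus_binaryQuartic]
  refine Set.ncard_le_ncard ?_
    (Set.finite_of_ncard_ne_zero (by rw [ncard_zeroLocus_binaryQuartic]; norm_num))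
  rintro ⟨v, hv⟩ h
  obtain ⟨K, hK, hpK⟩ := exists_of_one_le_multiplicity h
  obtain ⟨q, hq, r, -, rfl⟩ := exists_crossLine_eq hK
  have hvq : v ∈ q.submodule := head_join v _ ▸ ((submodule_mk_le _).1 hpK).1
  obtain rfl := mk_eq_of_mem_submodule hv hvq
  exact hq

theorem ncard_multiple_points_le_of_mem_firstKind (hL : L ∈ firstKind) :
    {p : P3 | p.submodule ≤ L ∧ 2 ≤ multiplicity firstKind p}.ncard ≤ 2 := by
  obtain ⟨q, -, r, -, rfl⟩ := exists_crossLine_eq hL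
  refine (Set.ncard_le_ncard (t := {.mk ℂ (join q.rep 0) (join_ne_zero_left q.rep_nonzero 0),
    .mk ℂ (join 0 r.rep) (join_ne_zero_right 0 r.rep_nonzero)}) ?_).trans
      ((Set.ncard_insert_le _ _).trans_eq (by rw [Set.ncard_singleton]))
  rintro ⟨x, hx⟩ ⟨hxL, h2⟩
  obtain ⟨hhead, htail⟩ := (submodule_mk_le hx).1 hxL
  rw [SetLike.mem_coe, Submodule.mem_comap, Projectivization.submodule_eq,
    Submodule.mem_span_singleton] at hhead htail
  obtain ⟨a, ha⟩ := hhead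
  obtain ⟨b, hb⟩ := htail
  by_cases htail : tail x = 0
  · exact Or.inl ((Projectivization.mk_eq_mk_iff' ..).2
      ⟨a, ext_head_tail (by simp [ha]) (by simp [htail])⟩)
  by_cases hhead : head x = 0
  · exact Or.inr ((Projectivization.mk_eq_mk_iff' ..).2
      ⟨b, ext_head_tail (by simp [hhead]) (by simp [hb])⟩)
  exact absurd h2 (Nat.lt_succ_of_le (multiplicity_firstKind_le_one hx hhead htail)).not_ge

theorem finite_mixed_points :
    {p : P3 | 1 ≤ multiplicity firstKind p ∧ 1 ≤ multiplicity secondKind p}.Finite := by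
  refine (finite_setOf_two_le_multiplicity finite_linesOn_schurQuartic fun L hL => hL.1).subset
    fun p hp => ?_
  rw [Set.mem_ofPred_eq, ← firstKind_union_secondKind,
    multiplicity_union finite_firstKind finite_secondKind disjoint_firstKind_secondKind]
  exact Nat.add_le_add hp.1 hp.2

theorem twelve_le_ncard_mixed_points_of_mem_firstKind (hL : L ∈ firstKind) :
    12 ≤ {p : P3 | p.submodule ≤ L ∧ 1 ≤ multiplicity secondKind p}.ncard := by
  have hfin : {p : P3 | p.submodule ≤ L ∧ 1 ≤ multiplicity secondKind p}.Finite :=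
    finite_mixed_points.subset fun p hp => ⟨one_le_multiplicity finite_firstKind hL hp.1, hp.2⟩
  obtain ⟨⟨v, hv⟩, hqv, ⟨w, hw⟩, hrw, rfl⟩ := exists_crossLine_eq hL
  obtain ⟨c, hc, horbit⟩ := exists_ne_zero_forall_exists_mulVec_eq_smul hv
    ((mk_mem_zeroLocus binaryQuartic_smul hv).1 hqv) hw
    ((mk_mem_zeroLocus binaryQuartic_smul hw).1 hrw)
  have hinj : Function.Injective fun d : ℂ =>
      (Projectivization.mk ℂ (join v ((d * c) • w)) (join_ne_zero_left hv _) : P3) := by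
    intro d d' h
    obtain ⟨a, ha⟩ := (Projectivization.mk_eq_mk_iff' ..).1 h
    have hav : a • v = (1 : ℂ) • v := by simpa using congrArg head ha
    obtain rfl : a = 1 := smul_left_injective ℂ hv hav
    have hdw : (d' * c) • w = (d * c) • w := by simpa using congrArg tail ha
    exact (mul_right_cancel₀ hc (smul_left_injective ℂ hw hdw)).symm
  rw [← ncard_setOf_pow_eq (K := ℂ) (n := 12) one_ne_zero, ← Set.ncard_image_of_injective _ hinj]
  refine Set.ncard_le_ncard ?_ hfin
  rintro _ ⟨d, hd, rfl⟩
  obtain ⟨M, hM, hMv⟩ := horbit d hd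
  refine ⟨(submodule_mk_le _).2 ⟨?_, ?_⟩, one_le_multiplicity finite_secondKind
    (secondKind_eq ▸ Set.mem_image_of_mem graphLine hM)
    ((submodule_mk_le _).2 (join_mem_graphLine.2 hMv.symm))⟩
  · exact Submodule.mem_span_singleton.2 ⟨1, by simp⟩
  · exact Submodule.mem_span_singleton.2 ⟨d * c, by simp⟩

end Multiplicities

/-! ### Connectedness of the union of the lines of the second kind -/

section Connectedness

variable {M N : Matrix (Fin 2) (Fin 2) ℂ} {a b b' κ κ' : ℂ}

/-- The graphs of the symmetries `M` and `N` of the binary quartic share a point. -/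
def GraphsMeet (M N : Matrix (Fin 2) (Fin 2) ℂ) : Prop :=
  M ∈ quarticSymmetries ∧ N ∈ quarticSymmetries ∧ ∃ v, v ≠ 0 ∧ M *ᵥ v = N *ᵥ v

theorem GraphsMeet.symm (h : GraphsMeet M N) : GraphsMeet N M :=
  ⟨h.2.1, h.1, h.2.2.imp fun _ hv => ⟨hv.1, hv.2.symm⟩⟩

theorem GraphsMeet.mul_left {A : Matrix (Fin 2) (Fin 2) ℂ} (hA : A ∈ quarticSymmetries)
    (h : GraphsMeet M N) : GraphsMeet (A * M) (A * N) := by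
  obtain ⟨hM, hN, v, hv, hMN⟩ := h
  exact ⟨mul_mem hA hM, mul_mem hA hN, v, hv, by
    rw [← Matrix.mulVec_mulVec, hMN, Matrix.mulVec_mulVec]⟩

theorem graphsMeet_offDiagSymmetry_of_fst_eq (h : (a, b) ∈ coefficientPairs 9⁻¹)
    (h' : (a, b') ∈ coefficientPairs 9⁻¹) (hκ : κ ^ 3 = 1) :
    GraphsMeet (offDiagSymmetry a b κ) (offDiagSymmetry a b' κ) := by
  refine ⟨offDiagSymmetry_mem h hκ, offDiagSymmetry_mem h' hκ, ![1, 0], by simp, ?_⟩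
  rw [offDiagSymmetry_mulVec, offDiagSymmetry_mulVec]
  simp

theorem graphsMeet_offDiagSymmetry_of_pair_eq (h : (a, b) ∈ coefficientPairs 9⁻¹)
    (hκ : κ ^ 3 = 1) (hκ' : κ' ^ 3 = 1) :
    GraphsMeet (offDiagSymmetry a b κ) (offDiagSymmetry a b κ') := by
  have hb := (ne_zero_of_mem_coefficientPairs (by norm_num) h).2
  refine ⟨offDiagSymmetry_mem h hκ, offDiagSymmetry_mem h hκ', ![b, -2 * a], by simp [hb], ?_⟩
  rw [offDiagSymmetry_mulVec, offDiagSymmetry_mulVec]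
  ext i
  fin_cases i
  · rfl
  · simp only [Matrix.cons_val_zero, Matrix.cons_val_one, Fin.mk_one]
    ring

theorem exists_graphsMeet_offDiagSymmetry_one (ha : a ^ 4 = 9⁻¹) :
    ∃ b, (a, b) ∈ coefficientPairs 9⁻¹ ∧ GraphsMeet (offDiagSymmetry a b 1) 1 := by
  have hy : 1 + 3 * a ≠ 0 := by
    intro h
    obtain rfl : a = -1 / 3 := by linear_combination (1 / 3) * h
    norm_num at ha
  have hab : (a, (1 + a) / (1 + 3 * a)) ∈ coefficientPairs 9⁻¹ := by
    refine ⟨ha, ?_⟩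
    change a * ((1 + a) / (1 + 3 * a)) ^ 3 = 9⁻¹
    rw [div_pow, ← mul_div_assoc, div_eq_iff (pow_ne_zero 3 hy)]
    linear_combination ha
  refine ⟨_, hab, offDiagSymmetry_mem hab (one_pow 3), one_mem _, ![1, 1 + 3 * a], by simp, ?_⟩
  rw [offDiagSymmetry_mulVec, Matrix.one_mulVec]
  ext i
  fin_cases i
  · simp [div_mul_cancel₀ _ hy]
  · simp only [Matrix.cons_val_zero, Matrix.cons_val_one, Fin.mk_one, div_mul_cancel₀ _ hy]
    ring

theorem reflTransGen_graphsMeet_offDiagSymmetry_one (h : (a, b) ∈ coefficientPairs 9⁻¹)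
    (hκ : κ ^ 3 = 1) : Relation.ReflTransGen GraphsMeet (offDiagSymmetry a b κ) 1 := by
  obtain ⟨b', h', hmeet⟩ := exists_graphsMeet_offDiagSymmetry_one h.1
  exact .head (graphsMeet_offDiagSymmetry_of_pair_eq h hκ (one_pow 3))
    (.head (graphsMeet_offDiagSymmetry_of_fst_eq h h' (one_pow 3)) (.single hmeet))

theorem reflTransGen_graphsMeet_one (hM : M ∈ quarticSymmetries) :
    Relation.ReflTransGen GraphsMeet M 1 := by
  rcases mem_quarticSymmetries_iff.1 hM with ⟨a, d, h, rfl⟩ | ⟨a, b, κ, h, hκ, rfl⟩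
  · obtain ⟨c, hc⟩ := IsAlgClosed.exists_pow_nat_eq (9⁻¹ : ℂ) (n := 4) (by norm_num)
    obtain ⟨b, hcb, hmeet⟩ := exists_graphsMeet_offDiagSymmetry_one hc
    have hprod : (diagSymmetry a d * offDiagSymmetry c b 1) 0 1 ≠ 0 := by
      simp [diagSymmetry, offDiagSymmetry, (ne_zero_of_mem_coefficientPairs one_ne_zero h).1,
        (ne_zero_of_mem_coefficientPairs (by norm_num) hcb).2]
    have hstep := (hmeet.mul_left hM).symm
    obtain ⟨a', b', κ, h', hκ, heq⟩ := exists_eq_offDiagSymmetry (mul_mem hM hmeet.1) hprod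
    rw [mul_one, heq] at hstep
    exact .head hstep (reflTransGen_graphsMeet_offDiagSymmetry_one h' hκ)
  · exact reflTransGen_graphsMeet_offDiagSymmetry_one h hκ

theorem isConnected_setOf_le_graphLine : IsConnected {p : P3 | p.submodule ≤ graphLine M} := by
  have hpunctured : IsConnected {v : Fin 2 → ℂ | v ≠ 0} :=
    isConnected_compl_singleton_of_one_lt_rank
      (Module.lt_rank_of_lt_finrank (by simp [Module.finrank_pi_fintype])) 0
  have : ConnectedSpace {v : Fin 2 → ℂ // v ≠ 0} := isConnected_iff_connectedSpace.1 hpunctured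
  let f (v : {v : Fin 2 → ℂ // v ≠ 0}) : P3 :=
    Projectivization.mk' ℂ ⟨graphMap M v, join_ne_zero_left v.2 _⟩
  have hf : Continuous f :=
    continuous_coinduced_rng.comp
      ((graphMap M).continuous_of_finiteDimensional.comp continuous_subtype_val |>.subtype_mk _)
  have hrange : {p : P3 | p.submodule ≤ graphLine M} = Set.range f := by
    rw [← range_graphPoint]
    refine Set.Subset.antisymm ?_ ?_
    · rintro _ ⟨⟨v⟩, rfl⟩
      exact ⟨v, rfl⟩
    · rintro _ ⟨v, rfl⟩
      exact ⟨.mk ℂ v.1 v.2, rfl⟩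
  rw [hrange]
  exact isConnected_range hf

theorem GraphsMeet.inter_nonempty (h : GraphsMeet M N) :
    ({p : P3 | p.submodule ≤ graphLine M} ∩ {p | p.submodule ≤ graphLine N}).Nonempty := by
  obtain ⟨-, -, v, hv, hMN⟩ := h
  exact ⟨.mk ℂ (join v (M *ᵥ v)) (join_ne_zero_left hv _),
    (submodule_mk_le _).2 (join_mem_graphLine.2 rfl),
    (submodule_mk_le _).2 (join_mem_graphLine.2 hMN)⟩

theorem isConnected_unionOfLines_secondKind : IsConnected (unionOfLines secondKind) := by
  have hunion : unionOfLines secondKind =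
      ⋃ M ∈ quarticSymmetries, {p : P3 | p.submodule ≤ graphLine M} := by
    ext p
    simp [unionOfLines, secondKind_eq]
  rw [hunion]
  refine IsConnected.biUnion_of_reflTransGen ⟨1, one_mem _⟩
    (fun M _ => isConnected_setOf_le_graphLine) fun M hM N hN => ?_
  have : Std.Symm GraphsMeet := ⟨fun _ _ h => h.symm⟩
  have hchain : Relation.ReflTransGen GraphsMeet M N := (reflTransGen_graphsMeet_one hM).trans
    (Relation.ReflTransGen.stdSymm.symm _ _ (reflTransGen_graphsMeet_one hN))
  exact Relation.ReflTransGen.mono (fun A B hAB => ⟨hAB.inter_nonempty, hAB.1⟩) _ _ hchain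

theorem isTransversalArrangement_secondKind :
    IsTransversalArrangement schurQuartic secondKind where
  finite := finite_secondKind
  subset := Set.sdiff_subset
  transversal _ hL _ hM hne _ hv hv0 :=
    sup_eq_tangentSpace isSmoothQuartic_schurQuartic hL.1 hM.1 hne hv hv0
  connected := isConnected_unionOfLines_secondKind

end Connectedness

/-! ### Numbers of multiple points and the log Chern slope -/

theorem t_secondKind_two : t secondKind 2 = 144 := by
  have h := mul_t_eq finite_secondKind (fun L hL => hL.1.1) le_rfl fun L => ncard_double_points
  rw [ncard_secondKind] at h
  omega

theorem t_secondKind_three : t secondKind 3 = 64 := by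
  have h := mul_t_eq (k := 3) finite_secondKind (fun L hL => hL.1.1) (by norm_num)
    fun L => ncard_triple_points
  rw [ncard_secondKind] at h
  omega

theorem t_secondKind_of_four_le {k : ℕ} (hk : 4 ≤ k) : t secondKind k = 0 := by
  rw [t, Set.eq_empty_of_forall_notMem (s := {p | multiplicity secondKind p = k}) fun p hp =>
    ((multiplicity_secondKind_le p).trans_lt hk).ne hp, Set.ncard_empty]

theorem sum_Icc_mul_t_secondKind (g : ℕ → ℕ) :
    ∑ k ∈ Finset.Icc 2 secondKind.ncard, g k * t secondKind k = g 2 * 144 + g 3 * 64 := by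
  rw [ncard_secondKind, ← Finset.sum_subset (s₁ := {2, 3}) (by decide),
    Finset.sum_pair (by norm_num), t_secondKind_two, t_secondKind_three]
  intro k hk hk'
  rw [t_secondKind_of_four_le, mul_zero]
  simp only [Finset.mem_Icc, Finset.mem_insert, Finset.mem_singleton] at hk hk'
  omega

theorem f₀_secondKind : f₀ secondKind = 208 := by
  simpa [f₀] using sum_Icc_mul_t_secondKind fun _ => 1

theorem f₁_secondKind : f₁ secondKind = 480 := sum_Icc_mul_t_secondKind id

theorem logChernSlope_secondKind : logChernSlope secondKind = 64 / 25 := by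
  rw [logChernSlope, logChernOneSq, logChernTwo, ncard_secondKind, f₀_secondKind, f₁_secondKind]
  norm_num

/-- For a set of `48` lines, slope `64/25` amounts to the linear condition
`36 f₀ - 11 f₁ = 2208`; this is its left-hand side. -/
def weight (C : Set (Submodule ℂ V)) : ℤ := 36 * f₀ C - 11 * f₁ C

theorem weight_eq_of_logChernSlope_eq {C : Set (Submodule ℂ V)} (hn : C.ncard = 48)
    (h : logChernSlope C = 64 / 25) : weight C = 2208 := by
  have h0 : (logChernTwo C : ℚ) ≠ 0 := by
    intro h0
    rw [logChernSlope, h0, div_zero] at h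
    norm_num at h
  rw [logChernSlope, div_eq_div_iff h0 (by norm_num)] at h
  have hlin : logChernOneSq C * 25 = 64 * logChernTwo C := by exact_mod_cast h
  rw [logChernOneSq, logChernTwo, hn] at hlin
  rw [weight]
  push_cast at hlin
  linarith

/-- The contribution of a point of multiplicity `k` to `weight`. -/
def pointWeight (k : ℕ) : ℤ := if 2 ≤ k then 36 - 11 * k else 0

theorem sum_pointWeight {C : Set (Submodule ℂ V)} (hC : C.Finite) {P : Finset P3}
    (hP : ∀ p, 2 ≤ multiplicity C p → p ∈ P) :
    ∑ p ∈ P, pointWeight (multiplicity C p) = weight C := by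
  simp only [pointWeight]
  rw [← sum_mul_t_eq hC hP (fun k => 36 - 11 * (k : ℤ)), weight, f₀, f₁]
  push_cast
  rw [Finset.mul_sum, Finset.mul_sum, ← Finset.sum_sub_distrib]
  exact Finset.sum_congr rfl fun k _ => by ring

/-! ### Exchanging lines of the second kind for lines of the first kind -/

section Exchange

variable {C : Set (Submodule ℂ V)} {L : Submodule ℂ V} {p : P3}

/-- Per line of the first kind added at a point on `m` lines of the second kind, a lower bound for
the change of `2 * pointWeight`. -/
def gain (m : ℕ) : ℤ := if m = 0 then -4 else 28

/-- Per line of the second kind removed at a point on `m` lines of the second kind, an upper bound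
for the drop of `2 * pointWeight`. -/
def loss (m : ℕ) : ℤ := if m = 3 then 3 else 28

-- `2 * pointWeight` takes the values `0, 0, 28, 6, -16` at `0, …, 4`; the bound is attained at
-- `m₂ = 0, a = 4` and at `m₂ = 3, d = 2`.
theorem pointWeight_exchange {m₁ m₂ a d c : ℕ} (h1 : m₁ ≤ 4) (h2 : m₂ ≤ 3)
    (hmixed : 1 ≤ m₁ → 1 ≤ m₂ → m₁ = 1 ∧ m₂ = 1) (ha : a ≤ m₁) (hd : d ≤ m₂)
    (hc : c + d = a + m₂) :
    2 * pointWeight m₂ + gain m₂ * a - loss m₂ * d ≤ 2 * pointWeight c := by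
  obtain rfl : c = a + m₂ - d := by omega
  interval_cases m₁ <;> interval_cases m₂ <;> first
    | omega
    | (interval_cases a <;> interval_cases d <;> simp [pointWeight, gain, loss])

theorem multiplicity_linesOn_schurQuartic (p : P3) : multiplicity (linesOn schurQuartic) p =
    multiplicity firstKind p + multiplicity secondKind p := by
  rw [← firstKind_union_secondKind,
    multiplicity_union finite_firstKind finite_secondKind disjoint_firstKind_secondKind]

/-- The finitely many points that lie on at least two lines of the Schur quartic. -/
def multiplePoints : Finset P3 :=
  (finite_setOf_two_le_multiplicity finite_linesOn_schurQuartic fun _ hL => hL.1).toFinset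

theorem mem_multiplePoints :
    p ∈ multiplePoints ↔ 2 ≤ multiplicity firstKind p + multiplicity secondKind p := by
  rw [multiplePoints, Set.Finite.mem_toFinset, Set.mem_ofPred_eq, multiplicity_linesOn_schurQuartic]

theorem mem_multiplePoints_of_two_le (hC : C ⊆ linesOn schurQuartic)
    (hp : 2 ≤ multiplicity C p) : p ∈ multiplePoints :=
  mem_multiplePoints.2 <| multiplicity_linesOn_schurQuartic p ▸
    hp.trans (multiplicity_mono hC finite_linesOn_schurQuartic p)

open Classical in
theorem le_sum_gain_of_mem_firstKind (hL : L ∈ firstKind) :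
    328 ≤ ∑ p ∈ multiplePoints with p.submodule ≤ L, gain (multiplicity secondKind p) := by
  have hpure : {p ∈ {p ∈ multiplePoints | p.submodule ≤ L} |
      multiplicity secondKind p = 0}.card ≤ 2 := by
    refine le_trans ?_ (ncard_multiple_points_le_of_mem_firstKind hL)
    rw [← Set.ncard_coe_finset]
    refine Set.ncard_le_ncard (fun p hp => ?_) ((multiplePoints.finite_toSet).subset fun p hp =>
      mem_multiplePoints.2 (hp.2.trans (Nat.le_add_right ..)))
    simp only [Finset.coe_filter, Finset.mem_filter, Set.mem_ofPred_eq, mem_multiplePoints] at hp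
    exact ⟨hp.1.2, by omega⟩
  have hmixed : 12 ≤ {p ∈ {p ∈ multiplePoints | p.submodule ≤ L} |
      ¬ multiplicity secondKind p = 0}.card := by
    refine (twelve_le_ncard_mixed_points_of_mem_firstKind hL).trans ?_
    rw [← Set.ncard_coe_finset]
    refine Set.ncard_le_ncard fun p hp => ?_
    have := one_le_multiplicity finite_firstKind hL hp.1
    simp only [Finset.coe_filter, Finset.mem_filter, Set.mem_ofPred_eq, mem_multiplePoints] at hp ⊢
    exact ⟨⟨by omega, hp.1⟩, by omega⟩
  simp only [gain, Finset.sum_ite, Finset.sum_const, nsmul_eq_mul]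
  omega

open Classical in
theorem sum_loss_le_of_mem_secondKind (hL : L ∈ secondKind) :
    ∑ p ∈ multiplePoints with p.submodule ≤ L, loss (multiplicity secondKind p) ≤ 292 := by
  have htriple : {p ∈ {p ∈ multiplePoints | p.submodule ≤ L} |
      multiplicity secondKind p = 3}.card ≤ 4 := by
    have hcard := ncard_triple_points hL
    rw [← Set.ncard_coe_finset]
    refine (Set.ncard_le_ncard (fun p hp => ?_)
      (Set.finite_of_ncard_ne_zero (by omega))).trans_eq hcard
    simp only [Finset.coe_filter, Finset.mem_filter, Set.mem_ofPred_eq] at hp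
    exact ⟨hp.1.2, hp.2⟩
  have hother : {p ∈ {p ∈ multiplePoints | p.submodule ≤ L} |
      ¬ multiplicity secondKind p = 3}.card ≤ 6 + 4 := by
    have hcard := ncard_double_points hL
    have hfin : {p : P3 | p.submodule ≤ L ∧ 1 ≤ multiplicity firstKind p}.Finite :=
      finite_mixed_points.subset fun p hp =>
        ⟨hp.2, one_le_multiplicity finite_secondKind hL hp.1⟩
    rw [← Set.ncard_coe_finset]
    refine (Set.ncard_le_ncard (fun p hp => ?_)
      ((Set.finite_of_ncard_ne_zero (by omega)).union hfin)).trans ((Set.ncard_union_le _ _).trans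
        (Nat.add_le_add hcard.le (ncard_mixed_points_le_of_mem_secondKind hL)))
    have := multiplicity_secondKind_le p
    simp only [Finset.coe_filter, Finset.mem_filter, Set.mem_ofPred_eq, mem_multiplePoints] at hp
    by_cases hfirst : 1 ≤ multiplicity firstKind p
    · exact Or.inr ⟨hp.1.2, hfirst⟩
    · exact Or.inl ⟨hp.1.2, by omega⟩
  simp only [loss, Finset.sum_ite, Finset.sum_const, nsmul_eq_mul]
  omega

theorem union_secondKind_sdiff (hC : C ⊆ linesOn schurQuartic) :
    C ∪ secondKind \ C = C ∩ firstKind ∪ secondKind := by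
  have := firstKind_union_secondKind ▸ hC
  grind

theorem disjoint_inter_firstKind_secondKind : Disjoint (C ∩ firstKind) secondKind :=
  disjoint_firstKind_secondKind.mono_left Set.inter_subset_right

theorem ncard_add_ncard_secondKind_sdiff (hC : C ⊆ linesOn schurQuartic) :
    C.ncard + (secondKind \ C).ncard = (C ∩ firstKind).ncard + 48 := by
  rw [← Set.ncard_union_eq Set.disjoint_sdiff_right (finite_linesOn_schurQuartic.subset hC)
    finite_secondKind.sdiff, union_secondKind_sdiff hC,
    Set.ncard_union_eq disjoint_inter_firstKind_secondKind (finite_firstKind.inter_of_right C)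
      finite_secondKind, ncard_secondKind]

theorem multiplicity_add_multiplicity_secondKind_sdiff (hC : C ⊆ linesOn schurQuartic) (p : P3) :
    multiplicity C p + multiplicity (secondKind \ C) p =
      multiplicity (C ∩ firstKind) p + multiplicity secondKind p := by
  rw [← multiplicity_union (finite_linesOn_schurQuartic.subset hC) finite_secondKind.sdiff
    Set.disjoint_sdiff_right, union_secondKind_sdiff hC, multiplicity_union
    (finite_firstKind.inter_of_right C) finite_secondKind disjoint_inter_firstKind_secondKind]

theorem sum_gain_mul_multiplicity_ge (hC : C ⊆ firstKind) :
    328 * (C.ncard : ℤ) ≤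
      ∑ p ∈ multiplePoints, gain (multiplicity secondKind p) * multiplicity C p := by
  classical
  have hfin := finite_firstKind.subset hC
  rw [sum_mul_multiplicity _ hfin, Set.ncard_eq_toFinset_card _ hfin, mul_comm, ← nsmul_eq_mul]
  exact Finset.card_nsmul_le_sum _ _ _ fun L hL =>
    le_sum_gain_of_mem_firstKind (hC (hfin.mem_toFinset.1 hL))

theorem sum_loss_mul_multiplicity_le (hC : C ⊆ secondKind) :
    ∑ p ∈ multiplePoints, loss (multiplicity secondKind p) * multiplicity C p ≤
      292 * (C.ncard : ℤ) := by
  classical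
  have hfin := finite_secondKind.subset hC
  rw [sum_mul_multiplicity _ hfin, Set.ncard_eq_toFinset_card _ hfin, mul_comm, ← nsmul_eq_mul]
  exact Finset.sum_le_card_nsmul _ _ _ fun L hL =>
    sum_loss_le_of_mem_secondKind (hC (hfin.mem_toFinset.1 hL))

theorem two_mul_weight_secondKind_add_le (hC : C ⊆ linesOn schurQuartic) :
    2 * weight secondKind + 328 * ((C ∩ firstKind).ncard : ℤ) ≤
      2 * weight C + 292 * ((secondKind \ C).ncard : ℤ) := by
  have hpoint (p : P3) := pointWeight_exchange (multiplicity_firstKind_le_four p)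
    (multiplicity_secondKind_le p) multiplicity_eq_one_of_mixed
    (multiplicity_mono Set.inter_subset_right finite_firstKind p)
    (multiplicity_mono Set.sdiff_subset finite_secondKind p)
    (multiplicity_add_multiplicity_secondKind_sdiff hC p)
  have hsum := Finset.sum_le_sum fun p (_ : p ∈ multiplePoints) => hpoint p
  rw [Finset.sum_sub_distrib, Finset.sum_add_distrib, ← Finset.mul_sum, ← Finset.mul_sum,
    sum_pointWeight finite_secondKind fun p => mem_multiplePoints_of_two_le Set.sdiff_subset,
    sum_pointWeight (finite_linesOn_schurQuartic.subset hC)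
      fun p => mem_multiplePoints_of_two_le hC] at hsum
  have hgain := sum_gain_mul_multiplicity_ge (C := C ∩ firstKind) Set.inter_subset_right
  have hloss := sum_loss_mul_multiplicity_le (C := secondKind \ C) Set.sdiff_subset
  linarith

theorem eq_secondKind_of_logChernSlope_eq (hC : C ⊆ linesOn schurQuartic) (hn : C.ncard = 48)
    (hslope : logChernSlope C = 64 / 25) : C = secondKind := by
  have hweight := two_mul_weight_secondKind_add_le hC
  have hcard := ncard_add_ncard_secondKind_sdiff hC
  rw [weight_eq_of_logChernSlope_eq hn hslope,
    weight_eq_of_logChernSlope_eq ncard_secondKind logChernSlope_secondKind] at hweight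
  have hempty : (secondKind \ C).ncard = 0 := by omega
  rw [Set.ncard_eq_zero finite_secondKind.sdiff, Set.sdiff_eq_empty] at hempty
  exact (Set.eq_of_subset_of_ncard_le hempty (by rw [hn, ncard_secondKind])
    (finite_linesOn_schurQuartic.subset hC)).symm

end Exchange

end SchurQuarticLines

end

theorem mainTheorem3 :
    SchurQuarticLines.IsSmoothQuartic SchurQuarticLines.schurQuartic ∧
    (SchurQuarticLines.linesOn SchurQuarticLines.schurQuartic).ncard = 64 ∧
    SchurQuarticLines.firstKind.ncard = 16 ∧
    SchurQuarticLines.secondKind.ncard = 48 ∧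
    SchurQuarticLines.IsTransversalArrangement SchurQuarticLines.schurQuartic
      SchurQuarticLines.secondKind ∧
    SchurQuarticLines.t SchurQuarticLines.secondKind 2 = 144 ∧
    SchurQuarticLines.t SchurQuarticLines.secondKind 3 = 64 ∧
    (∀ k : ℕ, 4 ≤ k → SchurQuarticLines.t SchurQuarticLines.secondKind k = 0) ∧
    SchurQuarticLines.logChernSlope SchurQuarticLines.secondKind = 64 / 25 ∧
    5 / 2 < SchurQuarticLines.logChernSlope SchurQuarticLines.secondKind ∧
    SchurQuarticLines.logChernSlope SchurQuarticLines.secondKind < 8 / 3 ∧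
    (∃! C : Set (Submodule ℂ SchurQuarticLines.V),
      C.ncard = 48 ∧
      SchurQuarticLines.IsTransversalArrangement SchurQuarticLines.schurQuartic C ∧
      SchurQuarticLines.logChernSlope C = 64 / 25) := by
  open SchurQuarticLines in
  refine ⟨isSmoothQuartic_schurQuartic, ncard_linesOn_schurQuartic, ncard_firstKind,
    ncard_secondKind, isTransversalArrangement_secondKind, t_secondKind_two, t_secondKind_three,
    fun _ => t_secondKind_of_four_le, logChernSlope_secondKind, ?_, ?_, secondKind,
    ⟨ncard_secondKind, isTransversalArrangement_secondKind, logChernSlope_secondKind⟩,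
    fun C hC => eq_secondKind_of_logChernSlope_eq hC.2.1.subset hC.1 hC.2.2⟩ <;>
  · rw [logChernSlope_secondKind]
    norm_num
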